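/- Let $p\ge 5$ be an odd integer, let $m=\frac{p-1}{2}$, and let $\mathcal E=\{e_k\}_{k\ge 0}$ be a sequence of positive integers. Let $S=S_{0,p}$ be the $p$-punctured sphere, regarded as the double of a regular $p$-gon with its vertices removed, and let $\rho\colon S\to S$ be the counterclockwise rotation by the angle $4\pi/p$. A curve means the isotopy class of an essential simple closed curve in $S$ (one bounding neither a disc nor a once-punctured disc), $\mathrm{i}(\cdot,\cdot)$ is the geometric intersection number, and $D_\gamma$ is the positive (left) Dehn twist about $\gamma$. Let $\gamma_0$ be the curve obtained by doubling an arc of the $p$-gon that connects the two sides adjacent to a common side. Put $\alpha=\rho^m(\gamma_0)$ and, for $k\ge 1$, $$\phi_k=D_\alpha^{e_{k+m-1}}\rho,\qquad \Phi_k=\phi_1\phi_2\cdots\phi_k,\qquad \Phi_0=\mathrm{id},$$ and let $\gamma_k=\Phi_k(\gamma_0)$ for $k\ge 0$. Then the sequence $\{\gamma_k\}_{k\ge0}$ satisfies condition $\mathcal P(\mathcal E)$ with parameters $m$ and $b=b'=2$. That is, $1\le m\le \xi(S)=p-3$, and: (i) any $m$ consecutive curves $\gamma_k,\dots,\gamma_{k+m-1}$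 are pairwise disjoint, i.e. have pairwise disjoint representatives; (ii) any $2m$ consecutive curves $\gamma_k,\dots,\gamma_{k+2m-1}$ fill $S$, i.e. every curve in $S$ has positive intersection number with at least one of them; (iii) for every $k\ge m$ there is a curve $\gamma'_{k+m}$ with $\gamma_{k+m}=D_{\gamma_k}^{e_k}(\gamma'_{k+m})$ and $$\mathrm{i}(\gamma'_{k+m},\gamma_j)\ \begin{cases}\le 2 & \text{for } j=k-m,\dots,k+m-1,\\ =2 & \text{for } j=k,\,k-1,\\ =0 & \text{for } j=k+1,\dots,k+m-1.\end{cases}$$ -/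

import Mathlib

noncomputable section

namespace PuncturedSphere

/-! ### The punctured sphere -/

/-- The unit sphere in `ℂ × ℝ = ℝ³`.  Through `(w, t) ↦ w` it is the double of the closed unit disc,
the upper hemisphere `t ≥ 0` being the front copy. -/
def Sphere : Type := {x : ℂ × ℝ // ‖x.1‖ ^ 2 + x.2 ^ 2 = 1}

instance : TopologicalSpace Sphere := inferInstanceAs (TopologicalSpace (Subtype _))

/-- The vertices of the regular `p`-gon inscribed in the equator: the points `(ζ, 0)` with
`ζ ^ p = 1` (the last coordinate vanishes automatically).  The surface `S_{0,p}` is the complement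
of this set. -/
def punctures (p : ℕ) : Set Sphere := {x | x.1.1 ^ p = 1}

/-- `f` is isotopic to the identity through homeomorphisms of the sphere fixing every point of
`Q`. -/
def IsotopicToId (Q : Set Sphere) (f : Sphere ≃ₜ Sphere) : Prop :=
  ∃ F : unitInterval → (Sphere ≃ₜ Sphere), Continuous (fun x : unitInterval × Sphere => F x.1 x.2) ∧
    F 0 = 1 ∧ F 1 = f ∧ ∀ t, ∀ q ∈ Q, F t q = q

/-- Orientation-preserving homeomorphisms of the sphere.  A homeomorphism of the two-sphere
preserves the orientation exactly when it is isotopic to the identity. -/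
def OrientationPreserving (f : Sphere ≃ₜ Sphere) : Prop := IsotopicToId ∅ f

/-- The homeomorphisms of `S_{0,p}`, each written as its unique extension to the sphere, that is,
as a homeomorphism of the sphere that maps the set of punctures onto itself. -/
def Homeo (p : ℕ) : Subgroup (Sphere ≃ₜ Sphere) where
  carrier := {f | ∀ x, f x ∈ punctures p ↔ x ∈ punctures p}
  mul_mem' {f g} hf hg x := (hf (g x)).trans (hg x)
  one_mem' _ := Iff.rfl
  inv_mem' {f} hf x := by
    have h := hf (f.symm x)
    rw [f.apply_symm_apply] at h
    exact h.symm

/-! ### Curves -/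

/-- A simple closed curve in `S_{0,p}` (as a subset) that is essential: each side of it contains at
least two punctures.  On a sphere both sides of a simple closed curve are open discs, so this says
that the curve bounds neither a disc nor a once-punctured disc, i.e. that it is homotopic neither to
a point nor to a puncture. -/
structure EssentialCurve (p : ℕ) where
  carrier : Set Sphere
  isSimpleClosed : ∃ f : Circle → Sphere, Continuous f ∧ Function.Injective f ∧ Set.range f = carrier
  avoids : Disjoint carrier (punctures p)
  separates : ¬ IsPreconnected carrierᶜ
  two_punctures : ∀ x ∈ carrierᶜ, (connectedComponentIn carrierᶜ x ∩ punctures p).Nontrivial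

variable {p : ℕ}

theorem EssentialCurve.ext' {c d : EssentialCurve p} (h : c.carrier = d.carrier) : c = d := by
  cases c; cases d; cases h; rfl

/-- The image of an essential simple closed curve under a homeomorphism. -/
def EssentialCurve.map (f : Homeo p) (c : EssentialCurve p) : EssentialCurve p where
  carrier := f.1 '' c.carrier
  isSimpleClosed := by
    obtain ⟨g, hg, hi, hr⟩ := c.isSimpleClosed
    exact ⟨f.1 ∘ g, f.1.continuous.comp hg, f.1.injective.comp hi, by rw [Set.range_comp, hr]⟩
  avoids := by
    rw [Set.disjoint_left]
    rintro _ ⟨x, hx, rfl⟩ h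
    exact Set.disjoint_left.1 c.avoids hx ((f.2 x).1 h)
  separates := by
    rw [← Set.image_compl_eq f.1.bijective, f.1.isPreconnected_image]
    exact c.separates
  two_punctures := by
    rw [← Set.image_compl_eq f.1.bijective]
    rintro _ ⟨x, hx, rfl⟩
    rw [← f.1.image_connectedComponentIn hx]
    obtain ⟨a, ha, b, hb, hab⟩ := c.two_punctures x hx
    exact ⟨f.1 a, ⟨⟨a, ha.1, rfl⟩, (f.2 a).2 ha.2⟩, f.1 b, ⟨⟨b, hb.1, rfl⟩, (f.2 b).2 hb.2⟩,
      fun h => hab (f.1.injective h)⟩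

/-- Two curves are isotopic if an ambient isotopy of the punctured sphere carries one onto the
other. -/
def Isotopic (c d : EssentialCurve p) : Prop :=
  ∃ f : Sphere ≃ₜ Sphere, IsotopicToId (punctures p) f ∧ f '' c.carrier = d.carrier

theorem IsotopicToId.one (Q : Set Sphere) : IsotopicToId Q 1 :=
  ⟨fun _ => 1, continuous_snd, rfl, rfl, fun _ _ _ => rfl⟩

theorem IsotopicToId.mul {Q : Set Sphere} {f g : Sphere ≃ₜ Sphere} (hf : IsotopicToId Q f)
    (hg : IsotopicToId Q g) : IsotopicToId Q (f * g) := by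
  obtain ⟨F, hF, F0, F1, FQ⟩ := hf
  obtain ⟨G, hG, G0, G1, GQ⟩ := hg
  refine ⟨fun t => F t * G t, ?_, by simp [F0, G0], by simp [F1, G1], fun t q hq => ?_⟩
  · exact hF.comp (continuous_fst.prodMk hG)
  · change F t (G t q) = q
    rw [GQ t q hq, FQ t q hq]

theorem IsotopicToId.inv {Q : Set Sphere} {f : Sphere ≃ₜ Sphere} (hf : IsotopicToId Q f) :
    IsotopicToId Q f⁻¹ := by
  obtain ⟨F, hF, F0, F1, FQ⟩ := hf
  refine ⟨fun t => F (unitInterval.symm t) * f⁻¹, ?_, by simp [F1], by simp [F0], fun t q hq => ?_⟩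
  · exact hF.comp ((unitInterval.continuous_symm.comp continuous_fst).prodMk
      (f.symm.continuous.comp continuous_snd))
  · have h : f.symm q = q := by
      rw [Homeomorph.symm_apply_eq, ← F1, FQ 1 q hq]
    change F (unitInterval.symm t) (f.symm q) = q
    rw [h, FQ _ q hq]

theorem IsotopicToId.conj {f : Sphere ≃ₜ Sphere} (hf : IsotopicToId (punctures p) f)
    (h : Homeo p) : IsotopicToId (punctures p) (h.1 * f * h.1⁻¹) := by
  obtain ⟨F, hF, F0, F1, FQ⟩ := hf
  refine ⟨fun t => h.1 * F t * h.1⁻¹, ?_, by simp [F0], by simp [F1], fun t q hq => ?_⟩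
  · exact h.1.continuous.comp
      (hF.comp (continuous_fst.prodMk (h.1.symm.continuous.comp continuous_snd)))
  · change h.1 (F t (h.1.symm q)) = q
    have h' : h.1.symm q ∈ punctures p := ((h⁻¹).2 q).2 hq
    rw [FQ t _ h', Homeomorph.apply_symm_apply]

instance isotopySetoid (p : ℕ) : Setoid (EssentialCurve p) where
  r := Isotopic
  iseqv :=
    { refl := fun c => ⟨1, .one _, Set.image_id _⟩
      symm := by
        rintro c d ⟨f, hf, h⟩
        refine ⟨f⁻¹, hf.inv, ?_⟩
        rw [← h]
        exact f.symm_image_image _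
      trans := by
        rintro a b c ⟨f, hf, h⟩ ⟨g, hg, h'⟩
        refine ⟨g * f, hg.mul hf, ?_⟩
        rw [← h', ← h, Set.image_image]
        rfl }

/-- A curve: the isotopy class of an essential simple closed curve in `S_{0,p}`. -/
def Curve (p : ℕ) : Type := Quotient (isotopySetoid p)

/-- The curve represented by `c`. -/
def EssentialCurve.toCurve (c : EssentialCurve p) : Curve p := Quotient.mk _ c

/-- Homeomorphisms act on curves. -/
instance : MulAction (Homeo p) (Curve p) where
  smul f := Quotient.map (EssentialCurve.map f) (by
    rintro c d ⟨g, hg, h⟩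
    refine ⟨f.1 * g * f.1⁻¹, hg.conj f, ?_⟩
    change _ '' (f.1 '' c.carrier) = f.1 '' d.carrier
    rw [← h, Set.image_image, Set.image_image]
    refine Set.image_congr fun x _ => ?_
    change f.1 (g (f.1.symm (f.1 x))) = _
    rw [Homeomorph.symm_apply_apply])
  one_smul a := by
    induction a using Quotient.inductionOn with
    | h c => exact congrArg (Quotient.mk _) (EssentialCurve.ext' (Set.image_id _))
  mul_smul f g a := by
    induction a using Quotient.inductionOn with
    | h c => exact congrArg (Quotient.mk _) (EssentialCurve.ext' (Set.image_comp f.1 g.1 _))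

/-- The geometric intersection number: the least number of intersection points of
representatives. -/
def intersection (a b : Curve p) : ℕ∞ :=
  ⨅ (c : EssentialCurve p) (_ : c.toCurve = a) (d : EssentialCurve p) (_ : d.toCurve = b),
    (c.carrier ∩ d.carrier).encard

/-- A family of curves is pairwise disjoint if it has pairwise disjoint representatives. -/
def PairwiseDisjointCurves {ι : Type} (γ : ι → Curve p) : Prop :=
  ∃ c : ι → EssentialCurve p, (∀ i, (c i).toCurve = γ i) ∧
    Pairwise fun i j => Disjoint (c i).carrier (c j).carrier

/-- A family of curves fills the surface if every curve has positive intersection number with one of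
them. -/
def Fills {ι : Type} (γ : ι → Curve p) : Prop :=
  ∀ δ : Curve p, ∃ i, intersection δ (γ i) ≠ 0

/-! ### Rotations and Dehn twists -/

/-- The homeomorphism `(w, t) ↦ (exp (i τ(t)) w, t)`, which turns the circle of latitude at height
`t` counterclockwise, seen from above, by the angle `τ t`. -/
def latitudeRotation (τ : C(ℝ, ℝ)) : Sphere ≃ₜ Sphere where
  toFun x := ⟨(Complex.exp (τ x.1.2 * Complex.I) * x.1.1, x.1.2), by
    simpa [Complex.norm_exp_ofReal_mul_I] using x.2⟩
  invFun x := ⟨(Complex.exp (-(τ x.1.2 * Complex.I)) * x.1.1, x.1.2), by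
    have h : ‖Complex.exp (-(τ x.1.2 * Complex.I))‖ = 1 := by
      rw [← neg_mul, ← Complex.ofReal_neg, Complex.norm_exp_ofReal_mul_I]
    simpa [h] using x.2⟩
  left_inv x := Subtype.ext (Prod.ext (by
    change Complex.exp (-(τ x.1.2 * Complex.I)) * (Complex.exp (τ x.1.2 * Complex.I) * x.1.1) = _
    rw [← mul_assoc, ← Complex.exp_add, neg_add_cancel, Complex.exp_zero, one_mul]) rfl)
  right_inv x := Subtype.ext (Prod.ext (by
    change Complex.exp (τ x.1.2 * Complex.I) * (Complex.exp (-(τ x.1.2 * Complex.I)) * x.1.1) = _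
    rw [← mul_assoc, ← Complex.exp_add, add_neg_cancel, Complex.exp_zero, one_mul]) rfl)
  continuous_toFun := by
    refine Continuous.subtype_mk ?_ _
    have h : Continuous fun x : Sphere => x.1 := continuous_subtype_val
    fun_prop
  continuous_invFun := by
    refine Continuous.subtype_mk ?_ _
    have h : Continuous fun x : Sphere => x.1 := continuous_subtype_val
    fun_prop

/-- The counterclockwise rotation `ρ` by the angle `4π/p`. -/
def rho (p : ℕ) : Homeo p :=
  ⟨latitudeRotation (.const ℝ (4 * Real.pi / p)), fun x => by
    rcases Nat.eq_zero_or_pos p with rfl | hp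
    · simp [punctures]
    · have h : Complex.exp (((4 * Real.pi / p : ℝ) : ℂ) * Complex.I) ^ p = 1 := by
        rw [← Complex.exp_nat_mul, Complex.exp_eq_one_iff]
        refine ⟨2, ?_⟩
        have : (p : ℂ) ≠ 0 := by exact_mod_cast hp.ne'
        push_cast
        field_simp
        ring
      change (Complex.exp (((4 * Real.pi / p : ℝ) : ℂ) * Complex.I) * x.1.1) ^ p = 1 ↔ _
      rw [mul_pow, h, one_mul]
      rfl⟩

/-- The equator. -/
def equator : Set Sphere := {x | x.1.2 = 0}

/-- The closed annulus `|t| ≤ 1/4` about the equator. -/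
def equatorialAnnulus : Set Sphere := {x | |x.1.2| ≤ 1 / 4}

/-- The positive (left) Dehn twist about the equator, supported in the equatorial annulus: from its
lower to its upper boundary circle the angle of rotation runs from `0` to `-2π`, so an arc going
north turns west, which is to its left as seen from outside the sphere. -/
def equatorTwist : Sphere ≃ₜ Sphere :=
  latitudeRotation ⟨fun t => -(2 * Real.pi) * max 0 (min 1 (2 * t + 1 / 2)), by fun_prop⟩

/-- `D` is a positive Dehn twist about the curve `a`: the standard twist transported by an
orientation-preserving homeomorphism `g` of the sphere that embeds the equatorial annulus in
`S_{0,p}` with core a representative of `a`.  (`D` is determined by `a` up to isotopy.) -/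
def IsPositiveDehnTwist (a : Curve p) (D : Homeo p) : Prop :=
  ∃ (g : Sphere ≃ₜ Sphere) (c : EssentialCurve p), OrientationPreserving g ∧
    Disjoint (g '' equatorialAnnulus) (punctures p) ∧
    c.carrier = g '' equator ∧ c.toCurve = a ∧
    D.1 = g * equatorTwist * g⁻¹

/-! ### The condition on sequences of curves -/

/-- The condition `𝒫(ℰ)` with parameters `m, b, b'` for a sequence of curves in `S_{0,p}`; the
complexity of `S_{0,p}` is `p - 3`. -/
structure SatisfiesP (m b b' : ℕ) (e : ℕ → ℕ) (γ : ℕ → Curve p) : Prop where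
  m_pos : 0 < m
  m_le : m + 3 ≤ p
  b_pos : 0 < b
  b_le : b ≤ b'
  disjoint : ∀ k, PairwiseDisjointCurves fun i : Fin m => γ (k + i)
  fill : ∀ k, Fills fun i : Fin (2 * m) => γ (k + i)
  twist : ∀ k, m ≤ k → ∃ γ' : Curve p,
    (∃ D : Homeo p, IsPositiveDehnTwist (γ k) D ∧ γ (k + m) = D ^ e k • γ') ∧
    (∀ j, k ≤ j + m → j < k + m → intersection γ' (γ j) ≤ b') ∧
    (∀ j, j = k ∨ j + 1 = k → intersection γ' (γ j) = b) ∧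
    (∀ j, k < j → j < k + m → intersection γ' (γ j) = 0)

/-! ### The sequence -/

/-- The component of a point of the sphere along the direction `(u, 0)`. -/
def height (u : Circle) (x : Sphere) : ℝ := (x.1.1 * (starRingEnd ℂ) (u : ℂ)).re

/-- The double of a chord of the unit disc: the circle cut out of the sphere by the vertical plane
at distance `a` from the origin in the direction `(u, 0)`. -/
def doubledChord (u : Circle) (a : ℝ) : Set Sphere := {x | height u x = a}

/-- The point of the sphere with component `l` along `(u, 0)` and angle `z` about this axis. -/
def axisPoint (u : Circle) (l : Set.Icc (-1 : ℝ) 1) (z : Circle) : Sphere :=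
  ⟨((u : ℂ) * (((l : ℝ) : ℂ) + ((√(1 - (l : ℝ) ^ 2) * (z : ℂ).re : ℝ) : ℂ) * Complex.I),
    √(1 - (l : ℝ) ^ 2) * (z : ℂ).im), by
    have hl : 0 ≤ 1 - (l : ℝ) ^ 2 := by nlinarith [l.2.1, l.2.2]
    have hz : (z : ℂ).re ^ 2 + (z : ℂ).im ^ 2 = 1 := by
      have := Circle.normSq_coe z
      rw [Complex.normSq_apply] at this
      nlinarith
    have hs := Real.sq_sqrt hl
    simp only [norm_mul, Circle.norm_coe, one_mul, ← Complex.normSq_eq_norm_sq,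
      Complex.normSq_add_mul_I]
    rw [mul_pow, mul_pow, hs]
    linear_combination (1 - (l : ℝ) ^ 2) * hz⟩

theorem continuous_axisPoint (u : Circle) :
    Continuous fun x : Set.Icc (-1 : ℝ) 1 × Circle => axisPoint u x.1 x.2 := by
  refine Continuous.subtype_mk ?_ _
  fun_prop

theorem circle_mul_conj (u : Circle) : (u : ℂ) * (starRingEnd ℂ) (u : ℂ) = 1 := by
  rw [Complex.mul_conj, Circle.normSq_coe, Complex.ofReal_one]

theorem height_axisPoint (u : Circle) (l : Set.Icc (-1 : ℝ) 1) (z : Circle) :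
    height u (axisPoint u l z) = l := by
  have h : (axisPoint u l z).1.1 * (starRingEnd ℂ) (u : ℂ) =
      ((l : ℝ) : ℂ) + ((√(1 - (l : ℝ) ^ 2) * (z : ℂ).re : ℝ) : ℂ) * Complex.I := by
    change (u : ℂ) * _ * _ = _
    rw [mul_right_comm, circle_mul_conj, one_mul]
  rw [height, h]
  simp

theorem exists_axisPoint (u : Circle) (x : Sphere) :
    ∃ (h : height u x ∈ Set.Icc (-1 : ℝ) 1) (z : Circle), axisPoint u ⟨height u x, h⟩ z = x := by
  set v : ℂ := x.1.1 * (starRingEnd ℂ) (u : ℂ) with hv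
  have hx : x.1.1 = u * v := by
    rw [hv, mul_left_comm, circle_mul_conj, mul_one]
  have hn : v.re ^ 2 + v.im ^ 2 + x.1.2 ^ 2 = 1 := by
    have h := x.2
    rw [hx, norm_mul, Circle.norm_coe, one_mul, ← Complex.normSq_eq_norm_sq,
      Complex.normSq_apply] at h
    linarith
  have hh : height u x = v.re := rfl
  have hI : height u x ∈ Set.Icc (-1 : ℝ) 1 := by
    rw [hh]
    constructor <;> nlinarith [sq_nonneg v.im, sq_nonneg x.1.2]
  refine ⟨hI, ?_⟩
  have key : ∃ z : Circle, √(1 - v.re ^ 2) * (z : ℂ).re = v.im ∧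
      √(1 - v.re ^ 2) * (z : ℂ).im = x.1.2 := by
    have hr : 1 - v.re ^ 2 = v.im ^ 2 + x.1.2 ^ 2 := by linarith
    by_cases h0 : v.im ^ 2 + x.1.2 ^ 2 = 0
    · refine ⟨1, ?_⟩
      have h1 : v.im = 0 := by nlinarith [sq_nonneg v.im, sq_nonneg x.1.2]
      have h2 : x.1.2 = 0 := by nlinarith [sq_nonneg v.im, sq_nonneg x.1.2]
      simp [hr, h1, h2]
    · have hpos : 0 < √(1 - v.re ^ 2) := by
        rw [hr]
        exact Real.sqrt_pos.2 (lt_of_le_of_ne (by positivity) (Ne.symm h0))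
      have hsq : √(1 - v.re ^ 2) ^ 2 = v.im ^ 2 + x.1.2 ^ 2 := by
        rw [hr]
        exact Real.sq_sqrt (by positivity)
      set r := √(1 - v.re ^ 2)
      refine ⟨⟨⟨v.im / r, x.1.2 / r⟩, ?_⟩, ?_, ?_⟩
      · rw [Submonoid.unitSphere, ← SetLike.mem_coe]
        change _ ∈ Metric.sphere (0 : ℂ) 1
        rw [mem_sphere_zero_iff_norm, ← sq_eq_sq₀ (norm_nonneg _) zero_le_one,
          ← Complex.normSq_eq_norm_sq, Complex.normSq_mk]
        field_simp
        linarith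
      · change r * (v.im / r) = _
        field_simp
      · change r * (x.1.2 / r) = _
        field_simp
  obtain ⟨z, hz1, hz2⟩ := key
  refine ⟨z, Subtype.ext (Prod.ext ?_ ?_)⟩
  · change (u : ℂ) * (((height u x : ℝ) : ℂ) +
      ((√(1 - height u x ^ 2) * (z : ℂ).re : ℝ) : ℂ) * Complex.I) = x.1.1
    rw [hh, hz1, hx, Complex.re_add_im]
  · change √(1 - height u x ^ 2) * (z : ℂ).im = x.1.2
    rw [hh, hz2]

theorem isPreconnected_height {u : Circle} {J : Set ℝ} (hJ : Convex ℝ J) :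
    IsPreconnected {x : Sphere | height u x ∈ J} := by
  have hle : (-1 : ℝ) ≤ 1 := by norm_num
  have hc : Continuous fun y : ℝ × ℝ =>
      axisPoint u (Set.projIcc (-1) 1 hle y.1) (Circle.exp y.2) :=
    (continuous_axisPoint u).comp
      (f := fun y : ℝ × ℝ => (Set.projIcc (-1) 1 hle y.1, Circle.exp y.2))
      (((continuous_projIcc (h := hle)).comp continuous_fst).prodMk (Circle.exp.continuous.comp continuous_snd))
  have h1 : Convex ℝ ((J ∩ Set.Icc (-1 : ℝ) 1) ×ˢ (Set.univ : Set ℝ)) :=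
    (hJ.inter (convex_Icc _ _)).prod convex_univ
  have h2 := h1.isPreconnected.image _ hc.continuousOn
  convert h2 using 1
  ext x
  constructor
  · intro hx
    obtain ⟨h, z, hz⟩ := exists_axisPoint u x
    refine ⟨(height u x, (z : ℂ).arg), ⟨⟨hx, h⟩, trivial⟩, ?_⟩
    change axisPoint u (Set.projIcc (-1) 1 _ (height u x)) (Circle.exp (z : ℂ).arg) = x
    rw [Set.projIcc_of_mem _ h, Circle.exp_arg, hz]
  · rintro ⟨⟨l, θ⟩, ⟨⟨hl, h⟩, -⟩, rfl⟩
    change height u (axisPoint u (Set.projIcc (-1) 1 _ l) _) ∈ J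
    rw [height_axisPoint, Set.projIcc_of_mem _ h]
    exact hl

theorem continuous_height (u : Circle) : Continuous (height u) := by
  have h : Continuous fun x : Sphere => x.1 := continuous_subtype_val
  unfold height
  fun_prop

/-- The vertex `exp (2πij/p)` of the polygon. -/
def vertex (p j : ℕ) : Sphere := ⟨((Circle.exp (2 * j * Real.pi / p) : Circle), 0), by
  rw [Circle.norm_coe]
  norm_num⟩

theorem vertex_mem (hp : 0 < p) (j : ℕ) : vertex p j ∈ punctures p := by
  change ((Circle.exp (2 * j * Real.pi / p) : Circle) : ℂ) ^ p = 1
  rw [Circle.coe_exp, ← Complex.exp_nat_mul, Complex.exp_eq_one_iff]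
  refine ⟨j, ?_⟩
  have : (p : ℂ) ≠ 0 := by exact_mod_cast hp.ne'
  push_cast
  field_simp

/-- The direction of the midpoint of the side joining vertex `s` to vertex `s + 1`. -/
def sideMid (p s : ℕ) : Circle := Circle.exp ((2 * s + 1) * Real.pi / p)

theorem height_exp (a b : ℝ) (h) :
    height (Circle.exp b) ⟨((Circle.exp a : Circle), 0), h⟩ = Real.cos (a - b) := by
  change (((Circle.exp a : Circle) : ℂ) * (starRingEnd ℂ) ((Circle.exp b : Circle) : ℂ)).re = _
  rw [← Circle.coe_inv_eq_conj, ← Circle.coe_mul, ← Circle.exp_neg, ← Circle.exp_add,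
    Circle.coe_exp, Complex.exp_ofReal_mul_I_re, sub_eq_add_neg]

theorem height_vertex (p j s : ℕ) :
    height (sideMid p s) (vertex p j) = Real.cos ((2 * j - (2 * s + 1)) * Real.pi / p) := by
  rw [sideMid, vertex, height_exp]
  congr 1
  ring

theorem vertex_ne (hp : 5 ≤ p) (j : ℕ) : vertex p j ≠ vertex p (j + 1) := by
  intro h
  have hp' : (0 : ℝ) < p := by positivity
  have h5 : (5 : ℝ) ≤ p := by exact_mod_cast hp
  have h2 := congrArg (height (Circle.exp (2 * j * Real.pi / p))) h
  rw [vertex, vertex, height_exp, height_exp, sub_self, Real.cos_zero] at h2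
  have h3 : 2 * ((j + 1 : ℕ) : ℝ) * Real.pi / p - 2 * j * Real.pi / p = 2 * Real.pi / p := by
    push_cast
    ring
  rw [h3] at h2
  have h4 : Real.cos (2 * Real.pi / p) < Real.cos 0 := by
    apply Real.cos_lt_cos_of_nonneg_of_le_pi le_rfl
    · rw [div_le_iff₀ hp']
      nlinarith [Real.pi_pos]
    · positivity
  rw [Real.cos_zero] at h4
  linarith

theorem height_ne_of_mem (hp : 0 < p) {s : ℕ} {x : Sphere} (hx : x ∈ punctures p) :
    height (sideMid p s) x ≠ Real.cos (3 / 2 * Real.pi / p) := by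
  intro h
  have hp' : (p : ℝ) ≠ 0 := by positivity
  set β : ℝ := 3 / 2 * Real.pi / p with hβ
  set v : ℂ := x.1.1 * (starRingEnd ℂ) (sideMid p s : ℂ) with hv
  have hre : v.re = Real.cos β := h
  have hw : ‖x.1.1‖ = 1 := Complex.norm_eq_one_of_pow_eq_one hx hp.ne'
  have hn : v.re ^ 2 + v.im ^ 2 = 1 := by
    have : Complex.normSq v = 1 := by
      rw [Complex.normSq_eq_norm_sq, hv, norm_mul, hw, RCLike.norm_conj, Circle.norm_coe]
      norm_num
    rw [Complex.normSq_apply] at this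
    linarith
  have him : v.im = Real.sin β ∨ v.im = -Real.sin β := by
    apply sq_eq_sq_iff_eq_or_eq_neg.1
    rw [hre] at hn
    linarith [Real.sin_sq_add_cos_sq β]
  have hpow : v ^ p = -1 := by
    have h1 : sideMid p s ^ p = Circle.exp (2 * s * Real.pi + Real.pi) := by
      rw [sideMid, ← Circle.exp_natCast_mul]
      congr 1
      field_simp
    have h2 : ((sideMid p s : Circle) : ℂ) ^ p = -1 := by
      rw [← Circle.coe_pow, h1, Circle.coe_exp]
      push_cast
      rw [add_mul, Complex.exp_add, Complex.exp_pi_mul_I,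
        Complex.exp_eq_one_iff.2 ⟨s, by push_cast; ring⟩, one_mul]
    have hx' : x.1.1 ^ p = 1 := hx
    rw [hv, mul_pow, hx', ← map_pow, h2, map_neg, map_one, one_mul]
  have key : ∀ c : ℝ, (c = 1 ∨ c = -1) → v ≠ ((Circle.exp (c * β) : Circle) : ℂ) := by
    intro c hc hv'
    rw [hv', ← Circle.coe_pow, ← Circle.exp_natCast_mul] at hpow
    have h3 : (p : ℝ) * (c * β) = c * (3 / 2 * Real.pi) := by
      rw [hβ]
      field_simp
    rw [h3, Circle.coe_exp] at hpow
    have h4 := congrArg Complex.re hpow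
    rw [Complex.exp_ofReal_mul_I_re] at h4
    have h5 : Real.cos (3 / 2 * Real.pi) = 0 := by
      rw [show 3 / 2 * Real.pi = Real.pi / 2 + Real.pi by ring, Real.cos_add_pi, Real.cos_pi_div_two,
        neg_zero]
    rcases hc with rfl | rfl
    · rw [one_mul, h5] at h4
      norm_num at h4
    · rw [neg_one_mul, Real.cos_neg, h5] at h4
      norm_num at h4
  rcases him with him | him
  · refine key 1 (.inl rfl) (Complex.ext ?_ ?_)
    · rw [one_mul, Circle.coe_exp, Complex.exp_ofReal_mul_I_re, hre]
    · rw [one_mul, Circle.coe_exp, Complex.exp_ofReal_mul_I_im, him]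
  · refine key (-1) (.inr rfl) (Complex.ext ?_ ?_)
    · rw [neg_one_mul, Circle.coe_exp, Complex.exp_ofReal_mul_I_re, Real.cos_neg, hre]
    · rw [neg_one_mul, Circle.coe_exp, Complex.exp_ofReal_mul_I_im, Real.sin_neg, him]

/-- The curve `γ₀`: the double of the chord, cutting off the side from vertex `s` to vertex `s + 1`,
whose end points lie on the two sides adjacent to that side (at angle `3π/(2p)` on either side of
its midpoint, while the nearest vertices are at angles `π/p` and `3π/p`). -/
def sideCurve (p s : ℕ) (hp : 5 ≤ p) : EssentialCurve p :=
  have hp' : (0 : ℝ) < p := by positivity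
  have h5 : (5 : ℝ) ≤ p := by exact_mod_cast hp
  have hpi := Real.pi_pos
  have bound : ∀ c d : ℝ, 0 ≤ c → c < d → d ≤ 5 →
      Real.cos (d * Real.pi / p) < Real.cos (c * Real.pi / p) := fun c d hc hcd hd => by
    apply Real.cos_lt_cos_of_nonneg_of_le_pi
    · positivity
    · rw [div_le_iff₀ hp']
      nlinarith
    · gcongr
  have hlt : Real.cos (3 / 2 * Real.pi / p) < 1 := by
    have := bound 0 (3 / 2) le_rfl (by norm_num) (by norm_num)
    simpa using this
  have hgt : -1 < Real.cos (3 / 2 * Real.pi / p) :=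
    (Real.neg_one_le_cos _).trans_lt (bound (3 / 2) 5 (by norm_num) (by norm_num) le_rfl)
  have v0 : height (sideMid p s) (vertex p s) = Real.cos (1 * Real.pi / p) := by
    rw [height_vertex, ← Real.cos_neg]
    congr 1
    ring
  have v1 : height (sideMid p s) (vertex p (s + 1)) = Real.cos (1 * Real.pi / p) := by
    rw [height_vertex]
    congr 1
    push_cast
    ring
  have v2 : height (sideMid p s) (vertex p (s + 2)) = Real.cos (3 * Real.pi / p) := by
    rw [height_vertex]
    congr 1
    push_cast
    ring
  have v3 : height (sideMid p s) (vertex p (s + 3)) = Real.cos (5 * Real.pi / p) := by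
    rw [height_vertex]
    congr 1
    push_cast
    ring
  have b1 := bound 1 (3 / 2) (by norm_num) (by norm_num) (by norm_num)
  have b3 := bound (3 / 2) 3 (by norm_num) (by norm_num) (by norm_num)
  have b5 := bound (3 / 2) 5 (by norm_num) (by norm_num) le_rfl
  { carrier := doubledChord (sideMid p s) (Real.cos (3 / 2 * Real.pi / p))
    isSimpleClosed := by
      refine ⟨axisPoint (sideMid p s) ⟨_, hgt.le, hlt.le⟩,
        (continuous_axisPoint _).comp (continuous_const.prodMk continuous_id), ?_, ?_⟩
      · intro z w h
        have hr : √(1 - Real.cos (3 / 2 * Real.pi / p) ^ 2) ≠ 0 :=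
          (Real.sqrt_pos.2 (by nlinarith)).ne'
        have h1 := congrArg (fun x : Sphere => x.1.1) h
        have h2 := congrArg (fun x : Sphere => x.1.2) h
        replace h1 := mul_left_cancel₀ (Circle.coe_ne_zero _) h1
        replace h1 := Complex.ofReal_injective
          (mul_right_cancel₀ Complex.I_ne_zero (add_left_cancel h1))
        exact Circle.ext (Complex.ext (mul_left_cancel₀ hr h1) (mul_left_cancel₀ hr h2))
      · ext x
        constructor
        · rintro ⟨z, rfl⟩
          exact height_axisPoint _ _ _
        · intro hx
          obtain ⟨h, z, hz⟩ := exists_axisPoint (sideMid p s) x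
          refine ⟨z, ?_⟩
          rw [← hz]
          congr 2
          exact (Set.mem_ofPred.1 hx).symm
    avoids := by
      rw [Set.disjoint_left]
      intro x hx hxp
      exact height_ne_of_mem (by omega) hxp hx
    separates := by
      intro h
      have hmem : Real.cos (3 / 2 * Real.pi / p) ∈ Set.Icc (height (sideMid p s) (vertex p (s + 2)))
          (height (sideMid p s) (vertex p s)) := by
        rw [v2, v0]
        exact ⟨b3.le, b1.le⟩
      have hv2 : vertex p (s + 2) ∈ (doubledChord (sideMid p s) (Real.cos (3 / 2 * Real.pi / p)))ᶜ :=
        fun hx => (v2 ▸ b3 :).ne hx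
      have hv0 : vertex p s ∈ (doubledChord (sideMid p s) (Real.cos (3 / 2 * Real.pi / p)))ᶜ :=
        fun hx => (v0 ▸ b1 :).ne' hx
      obtain ⟨x, hx, hx'⟩ := h.intermediate_value hv2 hv0
        (continuous_height (sideMid p s)).continuousOn hmem
      exact hx hx'
    two_punctures := by
      intro x hx
      rcases lt_or_gt_of_ne (show height (sideMid p s) x ≠ _ from hx) with h | h
      · have hs := (isPreconnected_height (u := sideMid p s) (convex_Iio _)).subset_connectedComponentIn
          (F := (doubledChord (sideMid p s) (Real.cos (3 / 2 * Real.pi / p)))ᶜ) h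
          fun y hy hy' => (ne_of_lt hy) hy'
        exact ⟨_, ⟨hs (v2 ▸ b3 :), vertex_mem (by omega) _⟩, _,
          ⟨hs (v3 ▸ b5 :), vertex_mem (by omega) _⟩, vertex_ne hp (s + 2)⟩
      · have hs := (isPreconnected_height (u := sideMid p s) (convex_Ioi _)).subset_connectedComponentIn
          (F := (doubledChord (sideMid p s) (Real.cos (3 / 2 * Real.pi / p)))ᶜ) h
          fun y hy hy' => (ne_of_gt hy) hy'
        exact ⟨_, ⟨hs (v0 ▸ b1 :), vertex_mem (by omega) _⟩, _,
          ⟨hs (v1 ▸ b1 :), vertex_mem (by omega) _⟩, vertex_ne hp s⟩ }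

/-- The product `Φ_k = φ_1 φ_2 ⋯ φ_k` of the homeomorphisms `φ_j = D ^ e_{j+m-1} ρ`. -/
def Phi (D : Homeo p) (m : ℕ) (e : ℕ → ℕ) : ℕ → Homeo p
  | 0 => 1
  | k + 1 => Phi D m e k * (D ^ e (k + m) * rho p)

end PuncturedSphere

/-! Write c_j for the curve around side j, with j read modulo p. Since ρ sends c_j to c_{j+2}, γ₀ =
c_s gives α = c_{s+2m}. Because p = 2m+1, the two neighbours of α are c_{s+2m+1} = c_s and
c_{s+2m-1} = c_{s+4m}. Every c_{s+2i} with 0 < i < 2m is α itself or disjoint from α, hence fixed by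
D. Therefore γ_{k+i} = Φ_k(c_{s+2i}) for 0 ≤ i < 2m (`Phi_add_smul_sideClass`): a window of 2m
consecutive curves is the image, under one homeomorphism, of all the side curves but one. Conditions
(i) and (ii) thus reduce to side curves. The twist is felt only at the next step, γ_{k+2m} = Φ_k
D^{e_{k+m}}(c_{s+4m}) (`Phi_add_two_mul_smul_sideClass`), so γ'_{k+m} = Φ_{k-m}(c_{s+4m}), and the
twist about γ_k is D conjugated by Φ_{k-m}. By `intersection_smul` the numbers in (iii) are those of
side curves: 2 for neighbours, 0 for non-neighbours.

Upper bounds come from the explicit circles. Lower bounds come from counting punctures: a curve that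
meets c_j at most once misses one side of c_j (`same_side_or_same_side`), and since each of its own
sides contains two punctures, it cannot separate the end points of side j
(`same_side_of_intersection_le_one`). This settles neighbours, and also filling: a curve with zero
intersection with p-1 consecutive c_j has all the punctures on one side.

Two facts about twists remain. A twist fixes a curve disjoint from its core because its support can
be squeezed towards the core. A twist about c_j exists because a conformal map carries the standard
annulus to a neighbourhood of c_j free of punctures. -/

namespace PuncturedSphere

variable {p : ℕ}

/-! ### Isotopies and twists -/

theorem latitudeRotation_apply (τ : C(ℝ, ℝ)) (x : Sphere) :
    (latitudeRotation τ x).1 = (Complex.exp (τ x.1.2 * Complex.I) * x.1.1, x.1.2) := rfl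

theorem latitudeRotation_eq_self (τ : C(ℝ, ℝ)) (x : Sphere)
    (h : τ x.1.2 = 0 ∨ τ x.1.2 = -(2 * Real.pi)) : latitudeRotation τ x = x := by
  refine Subtype.ext ?_
  rw [latitudeRotation_apply]
  have : Complex.exp (τ x.1.2 * Complex.I) = 1 := by
    rcases h with h | h
    · simp [h]
    · rw [h, Complex.exp_eq_one_iff]
      exact ⟨-1, by push_cast; ring⟩
  rw [this, one_mul]

theorem continuous_latitudeRotation {X : Type*} [TopologicalSpace X] {τ : X → C(ℝ, ℝ)}
    (hτ : Continuous fun y : X × ℝ => τ y.1 y.2) :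
    Continuous fun y : X × Sphere => latitudeRotation (τ y.1) y.2 := by
  refine Continuous.subtype_mk ?_ _
  have h : Continuous fun y : X × Sphere => y.2.1 := continuous_subtype_val.comp continuous_snd
  have h2 : Continuous fun y : X × Sphere => τ y.1 y.2.1.2 :=
    hτ.comp (continuous_fst.prodMk (continuous_snd.comp h))
  have h3 := Complex.continuous_ofReal.comp h2
  exact ((Complex.continuous_exp.comp (h3.mul continuous_const)).mul
    (continuous_fst.comp h)).prodMk (continuous_snd.comp h)

theorem orientationPreserving_latitudeRotation (τ : C(ℝ, ℝ)) :
    OrientationPreserving (latitudeRotation τ) := by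
  refine ⟨fun t => latitudeRotation ((t : ℝ) • τ), ?_, ?_, ?_, fun _ _ h => h.elim⟩
  · apply continuous_latitudeRotation (τ := fun t : unitInterval => (t : ℝ) • τ)
    change Continuous fun y : unitInterval × ℝ => (y.1 : ℝ) * τ y.2
    fun_prop
  · ext1 x
    exact latitudeRotation_eq_self _ _ (.inl (by simp))
  · simp

/-- The full negative turn along a ramp of slope `K` about the equator. -/
def rampTwist (K : ℝ) : Sphere ≃ₜ Sphere :=
  latitudeRotation ⟨fun t => -(2 * Real.pi) * max 0 (min 1 (K * t + 1 / 2)), by fun_prop⟩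

/-- Once |t| ≥ 1/(2K) the ramp is saturated and the rotation is trivial or a full turn. A steeper
ramp thus has a smaller support. -/
theorem rampTwist_eq_self {K : ℝ} {x : Sphere} (h : 1 / 2 ≤ K * |x.1.2|) : rampTwist K x = x := by
  apply latitudeRotation_eq_self
  change -(2 * Real.pi) * max 0 (min 1 (K * x.1.2 + 1 / 2)) = 0 ∨
    -(2 * Real.pi) * max 0 (min 1 (K * x.1.2 + 1 / 2)) = -(2 * Real.pi)
  rcases abs_cases x.1.2 with ⟨h1, -⟩ | ⟨h1, -⟩ <;> rw [h1] at h
  · right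
    rw [min_eq_left (by linarith), max_eq_right zero_le_one, mul_one]
  · left
    rw [max_eq_left ((min_le_right _ _).trans (by linarith)), mul_zero]

theorem rampTwist_two : rampTwist 2 = equatorTwist := rfl

theorem orientationPreserving_of_isPositiveDehnTwist {a : Curve p} {D : Homeo p}
    (h : IsPositiveDehnTwist a D) : OrientationPreserving D.1 := by
  obtain ⟨g, c, hg, -, -, -, hD⟩ := h
  rw [hD]
  exact (hg.mul (orientationPreserving_latitudeRotation _)).mul hg.inv

theorem IsPositiveDehnTwist.conj {a : Curve p} {D : Homeo p} (h : IsPositiveDehnTwist a D)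
    {f : Homeo p} (hf : OrientationPreserving f.1) :
    IsPositiveDehnTwist (f • a) (f * D * f⁻¹) := by
  obtain ⟨g, c, hg, hA, hc, rfl, hD⟩ := h
  refine ⟨f.1 * g, c.map f, hf.mul hg, ?_, ?_, rfl, ?_⟩
  · rw [Set.disjoint_left] at hA ⊢
    rintro _ ⟨x, hx, rfl⟩ hp
    exact hA ⟨x, hx, rfl⟩ ((f.2 _).1 hp)
  · change f.1 '' c.carrier = _
    rw [hc, Set.image_image]
    rfl
  · rw [Subgroup.coe_mul, Subgroup.coe_mul, hD, Subgroup.coe_inv]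
    group

theorem EssentialCurve.isCompact (c : EssentialCurve p) : IsCompact c.carrier := by
  obtain ⟨f, hf, -, h⟩ := c.isSimpleClosed
  rw [← h]
  exact isCompact_range hf

theorem toCurve_eq {c d : EssentialCurve p} : c.toCurve = d.toCurve ↔ Isotopic c d :=
  Quotient.eq (r := isotopySetoid p)

theorem smul_toCurve (f : Homeo p) (c : EssentialCurve p) : f • c.toCurve = (c.map f).toCurve := rfl

theorem IsotopicToId.toHomeo {f : Sphere ≃ₜ Sphere} (h : IsotopicToId (punctures p) f) :
    ∀ x, f x ∈ punctures p ↔ x ∈ punctures p := by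
  have key : ∀ {f : Sphere ≃ₜ Sphere}, IsotopicToId (punctures p) f →
      ∀ x ∈ punctures p, f x = x := by
    rintro f ⟨F, -, -, rfl, h⟩ x hx
    exact h 1 x hx
  intro x
  refine ⟨fun hx => ?_, fun hx => by rwa [key h x hx]⟩
  have h1 := key h.inv _ hx
  rw [show f⁻¹ (f x) = x from f.symm_apply_apply x] at h1
  rwa [h1]

/-- A Dehn twist fixes its core curve. -/
theorem IsPositiveDehnTwist.smul_self {a : Curve p} {D : Homeo p} (h : IsPositiveDehnTwist a D) :
    D • a = a := by
  obtain ⟨g, c, hg, hA, hc, rfl, hD⟩ := h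
  rw [smul_toCurve]
  congr 1
  apply EssentialCurve.ext'
  change D.1 '' c.carrier = c.carrier
  have hT : equatorTwist '' equator = equator := by
    ext x
    constructor
    · rintro ⟨y, hy, rfl⟩
      exact hy
    · intro hx
      exact ⟨equatorTwist.symm x, hx, equatorTwist.apply_symm_apply x⟩
  have : ∀ x, D.1 (g x) = g (equatorTwist x) := by
    intro x
    rw [hD]
    change g (equatorTwist (g.symm (g x))) = _
    rw [g.symm_apply_apply]
  rw [hc, Set.image_image]
  simp only [this]
  rw [← Set.image_image (g := g), hT]

/-- A Dehn twist fixes the curves disjoint from its core. -/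
theorem IsPositiveDehnTwist.smul_of_disjoint {a x : EssentialCurve p} {D : Homeo p}
    (h : IsPositiveDehnTwist a.toCurve D) (hx : Disjoint a.carrier x.carrier) :
    D • x.toCurve = x.toCurve := by
  obtain ⟨g, c, hg, hA, hc, hca, hD⟩ := h
  -- The core of the given twist is only isotopic to `a`; moving `x` by the same isotopy makes it
  -- disjoint from the actual core.
  obtain ⟨ψ, hψ, hac⟩ := toCurve_eq.1 hca.symm
  let y : EssentialCurve p := x.map ⟨ψ, hψ.toHomeo⟩
  have hy : x.toCurve = y.toCurve := toCurve_eq.2 ⟨ψ, hψ, rfl⟩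
  have hcy : Disjoint c.carrier y.carrier := by
    rw [← hac]
    exact (Set.disjoint_image_iff ψ.injective).2 hx
  rw [hy, smul_toCurve, toCurve_eq]
  -- `y` misses the core but may enter the annulus. By compactness it stays at positive distance
  -- from the core, so a ramp of large slope `K` does not move it.
  obtain ⟨K, hK, hfar⟩ : ∃ K : ℝ, 0 < K ∧ ∀ z ∈ y.carrier, 1 / 2 ≤ K * |(g.symm z).1.2| := by
    have hcont : Continuous fun z : Sphere => |(g.symm z).1.2| := by
      have h1 : Continuous fun z : Sphere => z.1 := continuous_subtype_val
      have h2 := h1.comp g.symm.continuous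
      exact (continuous_snd.comp h2).abs
    have hne : y.carrier.Nonempty := by
      obtain ⟨f, -, -, h⟩ := y.isSimpleClosed
      rw [← h]
      exact Set.range_nonempty f
    obtain ⟨z₀, hz₀, hmin⟩ := y.isCompact.exists_isMinOn hne hcont.continuousOn
    have hpos : 0 < |(g.symm z₀).1.2| := by
      rw [abs_pos]
      intro h0
      refine Set.disjoint_left.1 hcy ?_ hz₀
      rw [hc]
      exact ⟨g.symm z₀, h0, g.apply_symm_apply z₀⟩
    refine ⟨1 / 2 / |(g.symm z₀).1.2|, by positivity, fun z hz => ?_⟩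
    have hz' : |(g.symm z₀).1.2| ≤ |(g.symm z).1.2| := hmin hz
    rw [div_mul_eq_mul_div, le_div_iff₀ hpos]
    nlinarith
  obtain ⟨S, hS⟩ : ∃ S : unitInterval → ℝ, ∀ t, S t = 2 + t * max 0 (K - 2) := ⟨_, fun _ => rfl⟩
  have hSc : Continuous S := by
    rw [funext hS]
    fun_prop
  have hS2 : ∀ t, 2 ≤ S t := fun t => by
    have := mul_nonneg t.2.1 (le_max_left 0 (K - 2))
    rw [hS]
    linarith
  -- As the slope grows from 2 to `max 2 K`, this family runs from the identity to "undo `D`, then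
  -- apply the squeezed twist", which takes `D y` to `y`. All supports stay in the original annulus,
  -- so the punctures are fixed throughout.
  refine ⟨g * rampTwist (S 1) * equatorTwist⁻¹ * g⁻¹,
    ⟨fun t => g * rampTwist (S t) * equatorTwist⁻¹ * g⁻¹, ?_, ?_, rfl, ?_⟩, ?_⟩
  · have h1 : Continuous fun z : unitInterval × Sphere => rampTwist (S z.1) z.2 := by
      apply continuous_latitudeRotation (τ := fun t : unitInterval =>
        ⟨fun r => -(2 * Real.pi) * max 0 (min 1 (S t * r + 1 / 2)), by fun_prop⟩)
      change Continuous fun y : unitInterval × ℝ =>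
        -(2 * Real.pi) * max 0 (min 1 (S y.1 * y.2 + 1 / 2))
      fun_prop
    have h2 : Continuous fun z : unitInterval × Sphere => equatorTwist.symm (g.symm z.2) :=
      equatorTwist.symm.continuous.comp (g.symm.continuous.comp continuous_snd)
    have h3 : Continuous fun z : unitInterval × Sphere =>
        rampTwist (S z.1) (equatorTwist.symm (g.symm z.2)) :=
      h1.comp (g := fun z : unitInterval × Sphere => rampTwist (S z.1) z.2)
        (f := fun z : unitInterval × Sphere => (z.1, equatorTwist.symm (g.symm z.2)))
        (continuous_fst.prodMk h2)
    exact g.continuous.comp h3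
  · have : S 0 = 2 := by simp [hS]
    simp only [this, rampTwist_two]
    group
  · intro t q hq
    have hq' : 1 / 4 < |(g.symm q).1.2| := by
      by_contra! h
      exact Set.disjoint_left.1 hA ⟨g.symm q, h, g.apply_symm_apply q⟩ hq
    change g (rampTwist (S t) (equatorTwist.symm (g.symm q))) = q
    have h1 : equatorTwist.symm (g.symm q) = g.symm q := by
      rw [Homeomorph.symm_apply_eq, ← rampTwist_two, rampTwist_eq_self (by linarith)]
    rw [h1, rampTwist_eq_self (by nlinarith [hS2 t]), g.apply_symm_apply]
  · change _ '' (D.1 '' y.carrier) = y.carrier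
    rw [Set.image_image, hD]
    refine (Set.image_congr fun z hz => ?_).trans (Set.image_id _)
    change g (rampTwist (S 1) (equatorTwist.symm (g.symm (g (equatorTwist (g.symm z)))))) = z
    rw [g.symm_apply_apply, equatorTwist.symm_apply_apply, rampTwist_eq_self, g.apply_symm_apply]
    have h1 : K ≤ S 1 := by
      rw [hS, Set.Icc.coe_one]
      linarith [le_max_right 0 (K - 2)]
    have := hfar z hz
    nlinarith [abs_nonneg (g.symm z).1.2]

/-! ### Intersection numbers -/

theorem intersection_le (c d : EssentialCurve p) :
    intersection c.toCurve d.toCurve ≤ (c.carrier ∩ d.carrier).encard :=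
  iInf_le_of_le c (iInf_le_of_le rfl (iInf_le_of_le d (iInf_le _ rfl)))

/-- An infimum of a nonempty family in `ℕ∞` is attained, so minimal representatives may be chosen.
-/
theorem exists_encard_eq_intersection (a b : Curve p) : ∃ c d : EssentialCurve p,
    c.toCurve = a ∧ d.toCurve = b ∧ (c.carrier ∩ d.carrier).encard = intersection a b := by
  induction a using Quotient.inductionOn with
  | h c₀ =>
  induction b using Quotient.inductionOn with
  | h d₀ =>
  let ι := {c : EssentialCurve p // c.toCurve = c₀.toCurve} ×
    {d : EssentialCurve p // d.toCurve = d₀.toCurve}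
  have : Nonempty ι := ⟨⟨⟨c₀, rfl⟩, ⟨d₀, rfl⟩⟩⟩
  obtain ⟨⟨⟨c, hc⟩, ⟨d, hd⟩⟩, h⟩ := ciInf_mem fun x : ι => (x.1.1.carrier ∩ x.2.1.carrier).encard
  refine ⟨c, d, hc, hd, ?_⟩
  change (c.carrier ∩ d.carrier).encard = _ at h
  rw [h, iInf_prod]
  simp only [iInf_subtype]
  rfl

theorem intersection_smul_le (f : Homeo p) (a b : Curve p) :
    intersection (f • a) (f • b) ≤ intersection a b := by
  obtain ⟨c, d, rfl, rfl, h⟩ := exists_encard_eq_intersection a b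
  rw [← h, smul_toCurve, smul_toCurve]
  refine (intersection_le _ _).trans_eq ?_
  change (f.1 '' c.carrier ∩ f.1 '' d.carrier).encard = _
  rw [← Set.image_inter f.1.injective, f.1.injective.encard_image]

theorem intersection_smul (f : Homeo p) (a b : Curve p) :
    intersection (f • a) (f • b) = intersection a b := by
  refine (intersection_smul_le f a b).antisymm ?_
  simpa using intersection_smul_le f⁻¹ (f • a) (f • b)

theorem PairwiseDisjointCurves.smul {ι : Type} {γ : ι → Curve p} (h : PairwiseDisjointCurves γ)
    (f : Homeo p) : PairwiseDisjointCurves fun i => f • γ i := by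
  obtain ⟨c, hc, hd⟩ := h
  refine ⟨fun i => (c i).map f, fun i => by rw [← smul_toCurve, hc], fun i j hij => ?_⟩
  exact (Set.disjoint_image_iff f.1.injective).2 (hd hij)

theorem Fills.smul {ι : Type} {γ : ι → Curve p} (h : Fills γ) (f : Homeo p) :
    Fills fun i => f • γ i := by
  intro δ
  obtain ⟨i, hi⟩ := h (f⁻¹ • δ)
  refine ⟨i, ?_⟩
  rwa [← intersection_smul f, smul_inv_smul] at hi

/-! ### Sides of a curve -/

/-- The end of the isotopy fixes the punctures and carries complement to complement. Hence which
punctures share a side depends only on the isotopy class. -/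
theorem connectedComponentIn_iff_of_isotopic {c d : EssentialCurve p}
    (h : c.toCurve = d.toCurve) {x y : Sphere} (hx : x ∈ punctures p) (hy : y ∈ punctures p) :
    y ∈ connectedComponentIn c.carrierᶜ x ↔ y ∈ connectedComponentIn d.carrierᶜ x := by
  obtain ⟨f, ⟨F, -, -, rfl, hF⟩, hd⟩ := toCurve_eq.1 h
  have hxc : x ∈ c.carrierᶜ := fun h => Set.disjoint_left.1 c.avoids h hx
  have := (F 1).image_connectedComponentIn hxc
  rw [Set.image_compl_eq (F 1).bijective, hd, hF 1 x hx] at this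
  rw [← this]
  conv_rhs => rw [← hF 1 y hy]
  rw [(F 1).injective.mem_set_image]

theorem isPreconnected_circle_compl (z : Circle) : IsPreconnected ({z}ᶜ : Set Circle) := by
  have h : ({z}ᶜ : Set Circle) = (fun θ => z * Circle.exp θ) '' Set.Ioo 0 (2 * Real.pi) := by
    ext w
    constructor
    · intro hw
      obtain ⟨θ, hθ, h⟩ : ∃ θ ∈ Set.Ico 0 (0 + 2 * Real.pi), Circle.exp θ = z⁻¹ * w := by
        have := Circle.periodic_exp.exists_mem_Ico Real.two_pi_pos ((z⁻¹ * w : Circle) : ℂ).arg 0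
        obtain ⟨y, hy, h⟩ := this
        exact ⟨y, hy, by rw [← h, Circle.exp_arg]⟩
      rw [zero_add] at hθ
      refine ⟨θ, ⟨lt_of_le_of_ne hθ.1 ?_, hθ.2⟩, by simp [h]⟩
      rintro rfl
      rw [Circle.exp_zero, eq_comm, inv_mul_eq_one] at h
      exact hw h.symm
    · rintro ⟨θ, hθ, rfl⟩ h
      have h1 : Circle.exp θ = 1 := by simpa using h
      rw [Circle.exp_eq_one] at h1
      obtain ⟨n, hn⟩ := h1
      have h0 : 0 < (n : ℝ) := by
        by_contra! h
        nlinarith [hθ.1, Real.pi_pos]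
      have h2 : (n : ℝ) < 1 := by
        by_contra! h
        nlinarith [hθ.2, Real.pi_pos]
      have h0' : 0 < n := by exact_mod_cast h0
      have h2' : n < 1 := by exact_mod_cast h2
      omega
  rw [h]
  exact isPreconnected_Ioo.image _ (by fun_prop)

/-- A simple closed curve meeting a set in at most one point stays connected outside of it. -/
theorem isPreconnected_diff (d : EssentialCurve p) {C : Set Sphere}
    (h : (d.carrier ∩ C).encard ≤ 1) : IsPreconnected (d.carrier \ C) := by
  obtain ⟨f, hf, hi, hd⟩ := d.isSimpleClosed
  rw [Set.encard_le_one_iff_subsingleton] at h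
  rcases (d.carrier ∩ C).eq_empty_or_nonempty with h0 | ⟨x, hx⟩
  · rw [sdiff_eq_left.2 (Set.disjoint_iff_inter_eq_empty.2 h0), ← hd]
    exact isPreconnected_range hf
  · have hxd := hx.1
    rw [← hd] at hxd
    obtain ⟨z, rfl⟩ := hxd
    have : d.carrier \ C = f '' {z}ᶜ := by
      rw [Set.image_compl_eq_range_sdiff_image hi, Set.image_singleton, hd]
      ext y
      constructor
      · exact fun hy => ⟨hy.1, fun h' => hy.2 (h' ▸ hx.2)⟩
      · exact fun hy => ⟨hy.1, fun h' => hy.2 (h ⟨hy.1, h'⟩ hx)⟩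
    rw [this]
    exact (isPreconnected_circle_compl z).image _ hf.continuousOn

/-- If two curves meet at most once, then one of any two different sides of the first curve lies on
a single side of the second one. -/
theorem same_side_or_same_side {c d : EssentialCurve p} {x x' y y' : Sphere}
    (h : intersection d.toCurve c.toCurve ≤ 1)
    (hx : x ∈ punctures p) (hx' : x' ∈ punctures p) (hy : y ∈ punctures p) (hy' : y' ∈ punctures p)
    (hxx : x' ∈ connectedComponentIn c.carrierᶜ x) (hyy : y' ∈ connectedComponentIn c.carrierᶜ y)
    (hxy : y ∉ connectedComponentIn c.carrierᶜ x) :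
    x' ∈ connectedComponentIn d.carrierᶜ x ∨ y' ∈ connectedComponentIn d.carrierᶜ y := by
  obtain ⟨d₁, c₁, hd, hc, hdc⟩ := exists_encard_eq_intersection d.toCurve c.toCurve
  rw [← connectedComponentIn_iff_of_isotopic hc hx hx'] at hxx
  rw [← connectedComponentIn_iff_of_isotopic hc hy hy'] at hyy
  rw [← connectedComponentIn_iff_of_isotopic hc hx hy] at hxy
  rw [← connectedComponentIn_iff_of_isotopic hd hx hx', ← connectedComponentIn_iff_of_isotopic hd hy hy']
  rw [← hdc] at h
  have hcp : ∀ z ∈ punctures p, z ∈ c₁.carrierᶜ := fun z hz h' => Set.disjoint_left.1 c₁.avoids h' hz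
  -- If `d₁` entered both sides of `c₁`, the connected set `d₁ \ c₁` would join them.
  have key : Disjoint (connectedComponentIn c₁.carrierᶜ x) d₁.carrier ∨
      Disjoint (connectedComponentIn c₁.carrierᶜ y) d₁.carrier := by
    by_contra! hcon
    obtain ⟨a, ha, had⟩ := Set.not_disjoint_iff.1 hcon.1
    obtain ⟨b, hb, hbd⟩ := Set.not_disjoint_iff.1 hcon.2
    have hab : b ∈ connectedComponentIn c₁.carrierᶜ a :=
      (isPreconnected_diff d₁ h).subset_connectedComponentIn
      ⟨had, connectedComponentIn_subset _ _ ha⟩ (fun z hz => hz.2)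
      ⟨hbd, connectedComponentIn_subset _ _ hb⟩
    rw [← connectedComponentIn_eq ha] at hab
    rw [connectedComponentIn_eq hab, ← connectedComponentIn_eq hb] at hxy
    exact hxy (mem_connectedComponentIn (hcp y hy))
  have sub : ∀ {z z'}, z ∈ punctures p → z' ∈ connectedComponentIn c₁.carrierᶜ z →
      Disjoint (connectedComponentIn c₁.carrierᶜ z) d₁.carrier →
      z' ∈ connectedComponentIn d₁.carrierᶜ z := fun hz hzz hdis =>
    isPreconnected_connectedComponentIn.subset_connectedComponentIn
      (mem_connectedComponentIn (hcp _ hz))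
      (fun w hw => Set.disjoint_left.1 hdis hw) hzz
  exact key.imp (sub hx hxx) (sub hy hyy)

/-! ### The side curves -/

theorem sideMid_add_period (hp : 0 < p) (j : ℕ) : sideMid p (j + p) = sideMid p j := by
  have : (p : ℝ) ≠ 0 := by positivity
  rw [sideMid, sideMid, ← Circle.periodic_exp ((2 * (j : ℝ) + 1) * _ / _)]
  congr 1
  push_cast
  field_simp
  ring

/-- The class of the curve around the side from vertex `j` to vertex `j + 1`. -/
def sideClass (hp : 5 ≤ p) (j : ℕ) : Curve p := (sideCurve p j hp).toCurve

theorem sideCurve_carrier (hp : 5 ≤ p) (j : ℕ) : (sideCurve p j hp).carrier =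
    {x | height (sideMid p j) x = Real.cos (3 / 2 * Real.pi / p)} := rfl

theorem sideCurve_add_period (hp : 5 ≤ p) (j : ℕ) : sideCurve p (j + p) hp = sideCurve p j hp := by
  apply EssentialCurve.ext'
  rw [sideCurve_carrier, sideCurve_carrier, sideMid_add_period (by omega)]

theorem sideClass_add_period (hp : 5 ≤ p) (j : ℕ) : sideClass hp (j + p) = sideClass hp j := by
  rw [sideClass, sideCurve_add_period, sideClass]

theorem height_mul_latitudeRotation (u : Circle) (φ : ℝ) (x : Sphere) :
    height (Circle.exp φ * u) (latitudeRotation (.const ℝ φ) x) = height u x := by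
  have h : Complex.exp (φ * Complex.I) * (starRingEnd ℂ) (Circle.exp φ : ℂ) = 1 := by
    rw [← Circle.coe_exp, circle_mul_conj]
  rw [height, latitudeRotation_apply, Circle.coe_mul, map_mul, ContinuousMap.const_apply, height]
  congr 1
  linear_combination x.1.1 * (starRingEnd ℂ) (u : ℂ) * h

theorem rho_smul_sideClass (hp : 5 ≤ p) (j : ℕ) : rho p • sideClass hp j = sideClass hp (j + 2) := by
  rw [sideClass, smul_toCurve, sideClass]
  congr 1
  apply EssentialCurve.ext'
  have hu : sideMid p (j + 2) = Circle.exp (4 * Real.pi / p) * sideMid p j := by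
    rw [sideMid, sideMid, ← Circle.exp_add]
    congr 1
    push_cast
    ring
  change (rho p).1 '' (sideCurve p j hp).carrier = _
  rw [sideCurve_carrier, sideCurve_carrier, hu]
  ext x
  constructor
  · rintro ⟨y, hy, rfl⟩
    exact (height_mul_latitudeRotation _ _ y).trans hy
  · intro hx
    refine ⟨(rho p).1.symm x, ?_, (rho p).1.apply_symm_apply x⟩
    refine (height_mul_latitudeRotation _ (4 * Real.pi / p) _).symm.trans ?_
    exact (congrArg _ ((rho p).1.apply_symm_apply x)).trans hx

theorem rho_pow_smul_sideClass (hp : 5 ≤ p) (j i : ℕ) :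
    rho p ^ i • sideClass hp j = sideClass hp (j + 2 * i) := by
  induction i with
  | zero => simp
  | succ i ih => rw [pow_succ', mul_smul, ih, rho_smul_sideClass]; rfl

/-- The cosine decreases up to `d = p`, and `d ↦ 2p - d` reflects the rest of the range onto that
part without changing it. -/
theorem cos_lt_cos_pi_div (hp : 5 ≤ p) {c d : ℝ} (hc : 0 ≤ c) (hcd : c < d) (hd : d ≤ 2 * p - c)
    (hc' : d ≠ 2 * p - c) : Real.cos (d * Real.pi / p) < Real.cos (c * Real.pi / p) := by
  have hp' : (0 : ℝ) < p := by positivity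
  have hpi := Real.pi_pos
  rcases le_total d p with h | h
  · apply Real.cos_lt_cos_of_nonneg_of_le_pi
    · positivity
    · rw [div_le_iff₀ hp']
      nlinarith
    · gcongr
  · have : Real.cos (d * Real.pi / p) = Real.cos ((2 * p - d) * Real.pi / p) := by
      rw [← Real.cos_two_pi_sub]
      congr 1
      field_simp
    rw [this]
    apply Real.cos_lt_cos_of_nonneg_of_le_pi
    · positivity
    · rw [div_le_iff₀ hp']
      nlinarith
    · have : c < 2 * p - d := lt_of_le_of_ne (by linarith) fun h => hc' (by linarith)
      gcongr

/-! ### Position of the punctures relative to a side curve -/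

theorem exists_vertex_eq (hp : 5 ≤ p) (j : ℕ) {x : Sphere} (hx : x ∈ punctures p) :
    ∃ r < p, x = vertex p (j + r) := by
  have hp0 : p ≠ 0 := by omega
  have : NeZero p := ⟨hp0⟩
  have hζ := Complex.isPrimitiveRoot_exp p hp0
  have hv0 : (vertex p j).1.1 ^ p = 1 := vertex_mem (by omega) j
  have hv1 : (vertex p j).1.1 ≠ 0 := fun h => by rw [h, zero_pow hp0] at hv0; exact zero_ne_one hv0
  obtain ⟨r, hr, h⟩ := hζ.eq_pow_of_pow_eq_one
    (show (x.1.1 / (vertex p j).1.1) ^ p = 1 by rw [div_pow, hv0, div_one]; exact hx)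
  refine ⟨r, hr, ?_⟩
  have h1 : x.1.1 = (vertex p (j + r)).1.1 := by
    rw [eq_div_iff hv1] at h
    rw [← h]
    change _ * ((Circle.exp (2 * j * Real.pi / p) : Circle) : ℂ) =
      ((Circle.exp (2 * (j + r : ℕ) * Real.pi / p) : Circle) : ℂ)
    rw [Circle.coe_exp, Circle.coe_exp, ← Complex.exp_nat_mul, ← Complex.exp_add]
    congr 1
    push_cast
    ring
  have h2 : ∀ y ∈ punctures p, y.1.2 = 0 := by
    intro y hy
    have h3 : ‖y.1.1‖ = 1 := Complex.norm_eq_one_of_pow_eq_one hy hp0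
    have h4 := y.2
    rw [h3] at h4
    nlinarith
  exact Subtype.ext (Prod.ext h1 ((h2 x hx).trans (h2 _ (vertex_mem (by omega) _)).symm))

theorem height_vertex_self (hp : 5 ≤ p) (j : ℕ) :
    Real.cos (3 / 2 * Real.pi / p) < height (sideMid p j) (vertex p j) := by
  have h5 : (5 : ℝ) ≤ p := by exact_mod_cast hp
  have := cos_lt_cos_pi_div hp (c := 1) (d := 3 / 2) (by norm_num) (by norm_num) (by linarith)
    (by linarith)
  rw [height_vertex, ← Real.cos_neg ((_ - _) * _ / _)]
  convert this using 2
  ring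

theorem height_vertex_succ (hp : 5 ≤ p) (j : ℕ) :
    Real.cos (3 / 2 * Real.pi / p) < height (sideMid p j) (vertex p (j + 1)) := by
  have h5 : (5 : ℝ) ≤ p := by exact_mod_cast hp
  have := cos_lt_cos_pi_div hp (c := 1) (d := 3 / 2) (by norm_num) (by norm_num) (by linarith)
    (by linarith)
  rw [height_vertex]
  convert this using 2
  push_cast
  ring

/-- The angular distance from the midpoint of the side is (2r-1)π/p, where 3 ≤ 2r-1 ≤ 2p-3; the side
curve sits at angle 3π/(2p). -/
theorem height_vertex_add (hp : 5 ≤ p) (j : ℕ) {r : ℕ} (hr : 2 ≤ r) (hrp : r < p) :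
    height (sideMid p j) (vertex p (j + r)) < Real.cos (3 / 2 * Real.pi / p) := by
  have h2 : (2 : ℝ) ≤ r := by exact_mod_cast hr
  have h3 : (r : ℝ) + 1 ≤ p := by exact_mod_cast hrp
  have := cos_lt_cos_pi_div hp (c := 3 / 2) (d := 2 * r - 1) (by norm_num) (by linarith)
    (by linarith) (by linarith)
  rw [height_vertex]
  convert this using 2
  push_cast
  ring

theorem height_puncture (hp : 5 ≤ p) (j : ℕ) {x : Sphere} (hx : x ∈ punctures p) :
    x = vertex p j ∨ x = vertex p (j + 1) ∨
      height (sideMid p j) x < Real.cos (3 / 2 * Real.pi / p) := by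
  obtain ⟨r, hr, rfl⟩ := exists_vertex_eq hp j hx
  match r with
  | 0 => exact .inl rfl
  | 1 => exact .inr (.inl rfl)
  | r + 2 => exact .inr (.inr (height_vertex_add hp j (by omega) hr))

theorem mem_side_of_lt (hp : 5 ≤ p) (j : ℕ) {x y : Sphere}
    (hx : height (sideMid p j) x < Real.cos (3 / 2 * Real.pi / p))
    (hy : height (sideMid p j) y < Real.cos (3 / 2 * Real.pi / p)) :
    y ∈ connectedComponentIn (sideCurve p j hp).carrierᶜ x :=
  (isPreconnected_height (convex_Iio _)).subset_connectedComponentIn hx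
    (F := (sideCurve p j hp).carrierᶜ) (fun z hz hz' =>
      (show height (sideMid p j) z < Real.cos (3 / 2 * Real.pi / p) from hz).ne hz') hy

theorem mem_side_of_gt (hp : 5 ≤ p) (j : ℕ) {x y : Sphere}
    (hx : Real.cos (3 / 2 * Real.pi / p) < height (sideMid p j) x)
    (hy : Real.cos (3 / 2 * Real.pi / p) < height (sideMid p j) y) :
    y ∈ connectedComponentIn (sideCurve p j hp).carrierᶜ x :=
  (isPreconnected_height (convex_Ioi _)).subset_connectedComponentIn hx
    (F := (sideCurve p j hp).carrierᶜ) (fun z hz hz' =>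
      (show Real.cos (3 / 2 * Real.pi / p) < height (sideMid p j) z from hz).ne' hz') hy

/-- On a connected set joining the two points the height would take the value that defines the
curve. -/
theorem not_mem_side (hp : 5 ≤ p) (j : ℕ) {x y : Sphere}
    (hx : Real.cos (3 / 2 * Real.pi / p) < height (sideMid p j) x)
    (hy : height (sideMid p j) y < Real.cos (3 / 2 * Real.pi / p)) :
    y ∉ connectedComponentIn (sideCurve p j hp).carrierᶜ x := by
  intro h
  have hxx : x ∈ connectedComponentIn (sideCurve p j hp).carrierᶜ x :=
    mem_connectedComponentIn fun h' => hx.ne' h'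
  obtain ⟨z, hz, hz'⟩ := isPreconnected_connectedComponentIn.intermediate_value h hxx
    (continuous_height (sideMid p j)).continuousOn ⟨hy.le, hx.le⟩
  exact connectedComponentIn_subset _ _ hz hz'

/-- A curve meeting a side curve at most once does not separate the end points of the side. -/
theorem same_side_of_intersection_le_one (hp : 5 ≤ p) (j : ℕ) (d : EssentialCurve p)
    (h : intersection d.toCurve (sideClass hp j) ≤ 1) :
    vertex p (j + 1) ∈ connectedComponentIn d.carrierᶜ (vertex p j) := by
  by_contra hcon
  have hmem := vertex_mem (p := p) (by omega)
  have hd : ∀ x ∈ punctures p, x ∈ d.carrierᶜ := fun x hx hxd => Set.disjoint_left.1 d.avoids hxd hx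
  -- The inner side of the side curve contains two punctures separated by `d`, so `d` must enter it
  -- and cannot enter the outer one.
  have hlow : ∀ x ∈ punctures p, ∀ y ∈ punctures p,
      height (sideMid p j) x < Real.cos (3 / 2 * Real.pi / p) →
      height (sideMid p j) y < Real.cos (3 / 2 * Real.pi / p) →
      y ∈ connectedComponentIn d.carrierᶜ x := fun x hx y hy hxl hyl =>
    (same_side_or_same_side h (hmem j) (hmem (j + 1)) hx hy
      (mem_side_of_gt hp j (height_vertex_self hp j) (height_vertex_succ hp j))
      (mem_side_of_lt hp j hxl hyl)
      (not_mem_side hp j (height_vertex_self hp j) hxl)).resolve_left hcon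
  have hne : ∀ x ∈ punctures p, ∃ y ∈ punctures p, y ≠ x ∧ y ∈ connectedComponentIn d.carrierᶜ x := by
    intro x hx
    obtain ⟨y, hy, hyx⟩ := (d.two_punctures x (hd x hx)).exists_ne x
    exact ⟨y, hy.2, hyx, hy.1⟩
  -- Each end point of the side has a companion puncture on its own side of `d`. As `d` separates
  -- the end points, both companions lie outside the side curve, where `hlow` puts them on the same
  -- side of `d`.
  obtain ⟨x, hx, hx0, hxd⟩ := hne _ (hmem j)
  obtain ⟨y, hy, hy0, hyd⟩ := hne _ (hmem (j + 1))
  have hxl : height (sideMid p j) x < Real.cos (3 / 2 * Real.pi / p) := by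
    rcases height_puncture hp j hx with rfl | rfl | h
    · exact absurd rfl hx0
    · exact absurd hxd hcon
    · exact h
  have hyl : height (sideMid p j) y < Real.cos (3 / 2 * Real.pi / p) := by
    rcases height_puncture hp j hy with rfl | rfl | h
    · rw [← connectedComponentIn_eq hyd] at hcon
      exact absurd (mem_connectedComponentIn (hd _ (hmem _))) hcon
    · exact absurd rfl hy0
    · exact h
  have hxy := hlow x hx y hy hxl hyl
  rw [connectedComponentIn_eq hxd, connectedComponentIn_eq hxy, ← connectedComponentIn_eq hyd] at hcon
  exact hcon (mem_connectedComponentIn (hd _ (hmem _)))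

/-! ### Intersection numbers of side curves -/

theorem two_le_intersection_of_not_mem (hp : 5 ≤ p) (j k : ℕ)
    (h : vertex p (j + 1) ∉ connectedComponentIn (sideCurve p k hp).carrierᶜ (vertex p j)) :
    2 ≤ intersection (sideClass hp k) (sideClass hp j) := by
  by_contra! hlt
  refine h (same_side_of_intersection_le_one hp j _ ?_)
  exact Order.le_of_lt_add_one (hlt.trans_eq (by norm_num))

theorem vertex_add_period (hp : 0 < p) (j : ℕ) : vertex p (j + p) = vertex p j := by
  have hp' : (p : ℝ) ≠ 0 := by positivity
  have h : 2 * ((j + p : ℕ) : ℝ) * Real.pi / p = 2 * j * Real.pi / p + 2 * Real.pi := by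
    push_cast
    field_simp
  refine Subtype.ext (Prod.ext ?_ rfl)
  change ((Circle.exp _ : Circle) : ℂ) = ((Circle.exp _ : Circle) : ℂ)
  rw [h, Circle.periodic_exp]

theorem two_le_intersection_succ (hp : 5 ≤ p) (j : ℕ) :
    2 ≤ intersection (sideClass hp j) (sideClass hp (j + 1)) := by
  apply two_le_intersection_of_not_mem
  rw [add_assoc]
  exact not_mem_side hp j (height_vertex_succ hp j)
    (height_vertex_add hp j (r := 1 + 1) le_rfl (by omega))

theorem two_le_intersection_pred (hp : 5 ≤ p) (j : ℕ) :
    2 ≤ intersection (sideClass hp (j + 1)) (sideClass hp j) := by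
  apply two_le_intersection_of_not_mem
  intro h
  -- Indices are natural numbers, so vertex `j` is written as the last vertex counted from `j + 1`,
  -- to which `height_vertex_add` applies.
  rw [← vertex_add_period (by omega), show j + p = j + 1 + (p - 1) by omega] at h
  have h1 := height_vertex_add hp (j + 1) (r := p - 1) (by omega) (by omega)
  refine not_mem_side hp (j + 1) (height_vertex_self hp (j + 1)) h1 ?_
  rw [← connectedComponentIn_eq h]
  exact mem_connectedComponentIn fun h' => h1.ne h'

/-- With θ half the angle between the two directions, the sum of the two heights is 2 cos θ times
the height along the bisector, which is at most 1 in absolute value. At a common point the sum would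
be 2 cos(3π/(2p)), but 2π/p ≤ θ ≤ π - 2π/p makes |cos θ| smaller than cos(3π/(2p)). -/
theorem disjoint_sideCurve (hp : 5 ≤ p) {j k : ℕ} (h2 : j + 2 ≤ k) (hk : k + 2 ≤ j + p) :
    Disjoint (sideCurve p j hp).carrier (sideCurve p k hp).carrier := by
  rw [Set.disjoint_left]
  intro x hj hk'
  rw [sideCurve_carrier] at hj hk'
  have hp' : (0 : ℝ) < p := by positivity
  set θ : ℝ := (k - j) * Real.pi / p with hθ
  set β : ℝ := Real.cos (3 / 2 * Real.pi / p) with hβ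
  set u : Circle := Circle.exp ((j + k + 1) * Real.pi / p)
  have h5 : (5 : ℝ) ≤ p := by exact_mod_cast hp
  have h2' : (j : ℝ) + 2 ≤ k := by exact_mod_cast h2
  have hk2 : (k : ℝ) + 2 ≤ j + p := by exact_mod_cast hk
  have e1 : sideMid p j = u * Circle.exp (-θ) := by
    rw [sideMid, ← Circle.exp_add]
    congr 1
    rw [hθ]
    ring
  have e2 : sideMid p k = u * Circle.exp θ := by
    rw [sideMid, ← Circle.exp_add]
    congr 1
    rw [hθ]
    ring
  have hsum : ∀ x : Sphere, height (u * Circle.exp (-θ)) x + height (u * Circle.exp θ) x =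
      2 * Real.cos θ * height u x := by
    intro x
    simp only [height, Circle.coe_mul, map_mul, ← Circle.coe_inv_eq_conj, ← Circle.exp_neg, neg_neg]
    rw [← Complex.add_re, ← mul_add, ← mul_add, Circle.coe_exp, Circle.coe_exp, Complex.ofReal_neg,
      neg_mul, ← neg_mul, ← Complex.two_cos, ← mul_assoc, mul_comm, ← Complex.ofReal_cos,
      ← Complex.ofReal_ofNat, ← Complex.ofReal_mul, Complex.re_ofReal_mul]
  have hx := hsum x
  rw [← e1, ← e2, show height (sideMid p j) x = β from hj,
    show height (sideMid p k) x = β from hk'] at hx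
  obtain ⟨hh, -⟩ := exists_axisPoint u x
  have hβ0 : Real.cos θ < β := cos_lt_cos_pi_div hp (by norm_num) (by linarith) (by linarith)
    (by linarith)
  have hβ1 : -Real.cos θ < β := by
    rw [← Real.cos_pi_sub, show Real.pi - θ = (p - (k - j)) * Real.pi / p by rw [hθ]; field_simp]
    exact cos_lt_cos_pi_div hp (by norm_num) (by linarith) (by linarith) (by linarith)
  have h1 : |Real.cos θ * height u x| ≤ |Real.cos θ| := by
    rw [abs_mul]
    exact mul_le_of_le_one_right (abs_nonneg _) (abs_le.2 hh)
  have h3 := le_abs_self (Real.cos θ * height u x)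
  have h4 : |Real.cos θ| < β := abs_lt.2 ⟨by linarith, hβ0⟩
  linarith

theorem intersection_sideClass_eq_zero (hp : 5 ≤ p) {j k : ℕ} (h2 : j + 2 ≤ k)
    (hk : k + 2 ≤ j + p) : intersection (sideClass hp k) (sideClass hp j) = 0 := by
  refine le_antisymm ((intersection_le _ _).trans_eq ?_) bot_le
  rw [Set.encard_eq_zero, ← Set.disjoint_iff_inter_eq_empty]
  exact (disjoint_sideCurve hp h2 hk).symm

/-- Heights in two independent horizontal directions determine the horizontal component of a point,
and the sphere then leaves only the sign of the vertical one. -/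
theorem encard_inter_succ_le (hp : 5 ≤ p) (j : ℕ) :
    ((sideCurve p j hp).carrier ∩ (sideCurve p (j + 1) hp).carrier).encard ≤ 2 := by
  set S := (sideCurve p j hp).carrier ∩ (sideCurve p (j + 1) hp).carrier with hS
  have hp' : (0 : ℝ) < p := by positivity
  have h5 : (5 : ℝ) ≤ p := by exact_mod_cast hp
  have hsin : 0 < Real.sin (2 * Real.pi / p) := by
    apply Real.sin_pos_of_pos_of_lt_pi
    · positivity
    · rw [div_lt_iff₀ hp']
      nlinarith [Real.pi_pos]
  have hu : sideMid p (j + 1) = sideMid p j * Circle.exp (2 * Real.pi / p) := by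
    rw [sideMid, sideMid, ← Circle.exp_add]
    congr 1
    push_cast
    ring
  have hw : ∀ x ∈ S, ∀ y ∈ S, x.1.1 = y.1.1 := by
    intro x hx y hy
    have h1 : height (sideMid p j) x = height (sideMid p j) y := hx.1.trans hy.1.symm
    have h2 : height (sideMid p (j + 1)) x = height (sideMid p (j + 1)) y := hx.2.trans hy.2.symm
    rw [hu] at h2
    simp only [height, Circle.coe_mul, map_mul] at h1 h2
    have hu0 : (starRingEnd ℂ) (sideMid p j : ℂ) ≠ 0 := by simp
    apply mul_right_cancel₀ hu0
    refine Complex.ext h1 ?_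
    rw [← mul_assoc, ← mul_assoc] at h2
    generalize x.1.1 * (starRingEnd ℂ) (sideMid p j : ℂ) = v at *
    generalize y.1.1 * (starRingEnd ℂ) (sideMid p j : ℂ) = w at *
    rw [← Circle.coe_inv_eq_conj, ← Circle.exp_neg, Circle.coe_exp, Complex.mul_re, Complex.mul_re,
      Complex.exp_ofReal_mul_I_re, Complex.exp_ofReal_mul_I_im, Real.sin_neg, h1] at h2
    exact mul_right_cancel₀ hsin.ne' (by linarith)
  rcases S.eq_empty_or_nonempty with h | ⟨x, hx⟩
  · simp [h]
  · let x' : Sphere := ⟨(x.1.1, -x.1.2), by simpa using x.2⟩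
    refine (Set.encard_le_encard (t := {x, x'}) fun y hy => ?_).trans ?_
    swap
    · exact (Set.encard_insert_le _ _).trans (by rw [Set.encard_singleton]; norm_num)
    have h1 := hw y hy x hx
    have h2 := x.2
    have h3 := y.2
    rw [h1] at h3
    rcases sq_eq_sq_iff_eq_or_eq_neg.1 (show y.1.2 ^ 2 = x.1.2 ^ 2 by linarith) with h | h
    · exact .inl (Subtype.ext (Prod.ext h1 h))
    · exact .inr (Subtype.ext (Prod.ext h1 h))

theorem intersection_sideClass_succ (hp : 5 ≤ p) (j : ℕ) :
    intersection (sideClass hp j) (sideClass hp (j + 1)) = 2 :=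
  ((intersection_le _ _).trans (encard_inter_succ_le hp j)).antisymm (two_le_intersection_succ hp j)

theorem intersection_sideClass_pred (hp : 5 ≤ p) (j : ℕ) :
    intersection (sideClass hp (j + 1)) (sideClass hp j) = 2 := by
  refine ((intersection_le _ _).trans ?_).antisymm (two_le_intersection_pred hp j)
  rw [Set.inter_comm]
  exact encard_inter_succ_le hp j

/-- All but one of the side curves fill the punctured sphere. -/
theorem exists_intersection_sideClass_ne_zero (hp : 5 ≤ p) (j : ℕ) (δ : Curve p) :
    ∃ r, r + 1 < p ∧ intersection δ (sideClass hp (j + r)) ≠ 0 := by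
  induction δ using Quotient.inductionOn with
  | h d =>
  by_contra! hcon
  have hd : ∀ x ∈ punctures p, x ∈ d.carrierᶜ := fun x hx hxd => Set.disjoint_left.1 d.avoids hxd hx
  have hall : ∀ r < p, vertex p (j + r) ∈ connectedComponentIn d.carrierᶜ (vertex p j) := by
    intro r hr
    induction r with
    | zero => exact mem_connectedComponentIn (hd _ (vertex_mem (by omega) _))
    | succ r ih =>
      rw [connectedComponentIn_eq (ih (by omega))]
      exact same_side_of_intersection_le_one hp (j + r) d ((hcon r hr).le.trans zero_le_one)
  apply d.separates
  -- Every component of the complement contains a puncture, and all the punctures lie in this one.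
  have : d.carrierᶜ = connectedComponentIn d.carrierᶜ (vertex p j) := by
    refine (connectedComponentIn_subset _ _).antisymm' fun x hx => ?_
    obtain ⟨y, hy, -⟩ := (d.two_punctures x hx).exists_ne x
    obtain ⟨r, hr, h⟩ := exists_vertex_eq hp j hy.2
    rw [connectedComponentIn_eq (hall r hr), ← h, ← connectedComponentIn_eq hy.1]
    exact mem_connectedComponentIn hx
  rw [this]
  exact isPreconnected_connectedComponentIn

/-! ### A Dehn twist about a side curve -/

/-- The point of the sphere with given Cartesian coordinates. -/
def ofCoords (a b t : ℝ) (h : a ^ 2 + b ^ 2 + t ^ 2 = 1) : Sphere :=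
  ⟨(⟨a, b⟩, t), by
    change ‖(⟨a, b⟩ : ℂ)‖ ^ 2 + t ^ 2 = 1
    rw [Complex.sq_norm, Complex.normSq_mk]
    linarith⟩

theorem coords_sq (x : Sphere) : x.1.1.re ^ 2 + x.1.1.im ^ 2 + x.1.2 ^ 2 = 1 := by
  have h := x.2
  rw [Complex.sq_norm, Complex.normSq_apply] at h
  linarith

theorem sphere_ext {x y : Sphere} (h1 : x.1.1.re = y.1.1.re) (h2 : x.1.1.im = y.1.1.im)
    (h3 : x.1.2 = y.1.2) : x = y :=
  Subtype.ext (Prod.ext (Complex.ext h1 h2) h3)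

theorem continuous_ofCoords {X : Type*} [TopologicalSpace X] {a b t : X → ℝ} (ha : Continuous a)
    (hb : Continuous b) (ht : Continuous t) (h : ∀ x, a x ^ 2 + b x ^ 2 + t x ^ 2 = 1) :
    Continuous fun x => ofCoords (a x) (b x) (t x) (h x) := by
  refine Continuous.subtype_mk ?_ _
  exact (Complex.equivRealProdCLM.symm.continuous.comp (ha.prodMk hb)).prodMk ht

theorem continuous_coord_re : Continuous fun x : Sphere => x.1.1.re :=
  Complex.continuous_re.comp (continuous_fst.comp continuous_subtype_val)

theorem continuous_coord_im : Continuous fun x : Sphere => x.1.1.im :=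
  Complex.continuous_im.comp (continuous_fst.comp continuous_subtype_val)

theorem continuous_coord_t : Continuous fun x : Sphere => x.1.2 :=
  continuous_snd.comp continuous_subtype_val

/-- The rotation by the angle `θ` about the horizontal axis in the direction `I`, as a map. -/
def tiltFun (θ : ℝ) (x : Sphere) : Sphere :=
  ofCoords (Real.cos θ * x.1.1.re + Real.sin θ * x.1.2) x.1.1.im
    (-Real.sin θ * x.1.1.re + Real.cos θ * x.1.2) (by
      linear_combination coords_sq x + (x.1.1.re ^ 2 + x.1.2 ^ 2) * Real.sin_sq_add_cos_sq θ)

theorem tiltFun_neg (θ : ℝ) (x : Sphere) : tiltFun (-θ) (tiltFun θ x) = x := by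
  refine sphere_ext ?_ rfl ?_
  · change Real.cos (-θ) * (Real.cos θ * x.1.1.re + Real.sin θ * x.1.2) +
      Real.sin (-θ) * (-Real.sin θ * x.1.1.re + Real.cos θ * x.1.2) = _
    rw [Real.cos_neg, Real.sin_neg]
    linear_combination x.1.1.re * Real.sin_sq_add_cos_sq θ
  · change -Real.sin (-θ) * (Real.cos θ * x.1.1.re + Real.sin θ * x.1.2) +
      Real.cos (-θ) * (-Real.sin θ * x.1.1.re + Real.cos θ * x.1.2) = _
    rw [Real.cos_neg, Real.sin_neg]
    linear_combination x.1.2 * Real.sin_sq_add_cos_sq θ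

theorem continuous_tiltFun : Continuous fun y : ℝ × Sphere => tiltFun y.1 y.2 := by
  have h1 := continuous_coord_re.comp (continuous_snd (X := ℝ))
  have h2 := continuous_coord_im.comp (continuous_snd (X := ℝ))
  have h3 := continuous_coord_t.comp (continuous_snd (X := ℝ))
  have h4 := Real.continuous_cos.comp (continuous_fst (X := ℝ) (Y := Sphere))
  have h5 := Real.continuous_sin.comp (continuous_fst (X := ℝ) (Y := Sphere))
  exact continuous_ofCoords ((h4.mul h1).add (h5.mul h3)) h2 ((h5.neg.mul h1).add (h4.mul h3)) _

/-- The rotation by the angle `θ` about the horizontal axis in the direction `I`. -/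
def tilt (θ : ℝ) : Sphere ≃ₜ Sphere where
  toFun := tiltFun θ
  invFun := tiltFun (-θ)
  left_inv := tiltFun_neg θ
  right_inv x := by simpa using tiltFun_neg (-θ) x
  continuous_toFun := continuous_tiltFun.comp (f := fun x => (θ, x)) (by fun_prop)
  continuous_invFun := continuous_tiltFun.comp (f := fun x => (-θ, x)) (by fun_prop)

theorem orientationPreserving_tilt (θ : ℝ) : OrientationPreserving (tilt θ) := by
  refine ⟨fun s => tilt (s * θ), ?_, ?_, ?_, fun _ _ h => h.elim⟩
  · exact continuous_tiltFun.comp (f := fun y : unitInterval × Sphere => ((y.1 : ℝ) * θ, y.2))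
      (by fun_prop)
  · ext1 x
    change tiltFun ((0 : ℝ) * θ) x = x
    refine sphere_ext ?_ rfl ?_
    · change Real.cos ((0 : ℝ) * θ) * x.1.1.re + Real.sin ((0 : ℝ) * θ) * x.1.2 = _
      simp
    · change -Real.sin ((0 : ℝ) * θ) * x.1.1.re + Real.cos ((0 : ℝ) * θ) * x.1.2 = _
      simp
  · change tilt ((1 : ℝ) * θ) = _
    rw [one_mul]

theorem one_add_mul_re_pos {β : ℝ} (hβ : |β| < 1) (x : Sphere) : 0 < 1 + β * x.1.1.re := by
  have h := coords_sq x
  have h1 : |x.1.1.re| ≤ 1 := by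
    rw [← sq_le_one_iff_abs_le_one]
    nlinarith [sq_nonneg x.1.1.im, sq_nonneg x.1.2]
  have h2 : |β * x.1.1.re| < 1 := by
    rw [abs_mul]
    nlinarith [abs_nonneg β, abs_nonneg x.1.1.re]
  linarith [(abs_lt.1 h2).1]

theorem sq_sqrt_one_sub {β : ℝ} (hβ : |β| < 1) : √(1 - β ^ 2) ^ 2 = 1 - β ^ 2 :=
  Real.sq_sqrt (by linarith [(sq_lt_one_iff_abs_lt_one β).2 hβ])

/-- The conformal map of the sphere that pushes it in the direction `1`, as a map. -/
def boostFun (β : ℝ) (hβ : |β| < 1) (x : Sphere) : Sphere :=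
  ofCoords ((x.1.1.re + β) / (1 + β * x.1.1.re)) (√(1 - β ^ 2) * x.1.1.im / (1 + β * x.1.1.re))
    (√(1 - β ^ 2) * x.1.2 / (1 + β * x.1.1.re)) (by
      have h := (one_add_mul_re_pos hβ x).ne'
      have h2 := sq_sqrt_one_sub hβ
      have h3 := coords_sq x
      generalize x.1.1.re = a at *
      generalize x.1.1.im = b at *
      generalize x.1.2 = t at *
      obtain ⟨D, hD⟩ : ∃ D, D = 1 + β * a := ⟨_, rfl⟩
      rw [← hD] at h ⊢
      field_simp
      rw [h2]
      linear_combination (1 - β ^ 2) * h3 - (D + 1 + β * a) * hD)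

theorem boostFun_neg (β : ℝ) (hβ : |β| < 1) (hβ' : |-β| < 1) (x : Sphere) :
    boostFun (-β) hβ' (boostFun β hβ x) = x := by
  have h := (one_add_mul_re_pos hβ x).ne'
  have h2 := sq_sqrt_one_sub hβ
  have h3 : 1 - β ^ 2 ≠ 0 := by linarith [(sq_lt_one_iff_abs_lt_one β).2 hβ]
  have h4 : 1 + -β * ((x.1.1.re + β) / (1 + β * x.1.1.re)) = (1 - β ^ 2) / (1 + β * x.1.1.re) := by
    field_simp
    ring
  refine sphere_ext ?_ ?_ ?_
  · change ((x.1.1.re + β) / (1 + β * x.1.1.re) + -β) /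
      (1 + -β * ((x.1.1.re + β) / (1 + β * x.1.1.re))) = _
    rw [h4]
    generalize x.1.1.re = a at *
    obtain ⟨D, hD⟩ : ∃ D, D = 1 + β * a := ⟨_, rfl⟩
    rw [← hD] at h ⊢
    field_simp
    linear_combination -β * hD
  · change √(1 - (-β) ^ 2) * (√(1 - β ^ 2) * x.1.1.im / (1 + β * x.1.1.re)) /
      (1 + -β * ((x.1.1.re + β) / (1 + β * x.1.1.re))) = _
    rw [h4, neg_sq]
    field_simp
    rw [h2]
  · change √(1 - (-β) ^ 2) * (√(1 - β ^ 2) * x.1.2 / (1 + β * x.1.1.re)) /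
      (1 + -β * ((x.1.1.re + β) / (1 + β * x.1.1.re))) = _
    rw [h4, neg_sq]
    field_simp
    rw [h2]

theorem continuous_boostFun {X : Type*} [TopologicalSpace X] {β : X → ℝ} {f : X → Sphere}
    (hc : Continuous β) (hf : Continuous f) (hβ : ∀ x, |β x| < 1) :
    Continuous fun y => boostFun (β y) (hβ y) (f y) := by
  have h1 := continuous_coord_re.comp hf
  have h2 := continuous_coord_im.comp hf
  have h3 := continuous_coord_t.comp hf
  have h4 : Continuous fun y => √(1 - β y ^ 2) := by fun_prop
  have h5 : Continuous fun y => 1 + β y * (f y).1.1.re := continuous_const.add (hc.mul h1)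
  have h6 : ∀ y, 1 + β y * (f y).1.1.re ≠ 0 := fun y => (one_add_mul_re_pos (hβ y) _).ne'
  exact continuous_ofCoords ((h1.add hc).div h5 h6) ((h4.mul h2).div h5 h6)
    ((h4.mul h3).div h5 h6) _

/-- The conformal map of the sphere that pushes it in the direction `1`. -/
def boost (β : ℝ) (hβ : |β| < 1) : Sphere ≃ₜ Sphere where
  toFun := boostFun β hβ
  invFun := boostFun (-β) (by rwa [abs_neg])
  left_inv := boostFun_neg β hβ _
  right_inv x := by simpa using boostFun_neg (-β) (by rwa [abs_neg]) (by rwa [neg_neg]) x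
  continuous_toFun := continuous_boostFun continuous_const continuous_id fun _ => hβ
  continuous_invFun := continuous_boostFun continuous_const continuous_id fun _ => by rwa [abs_neg]

theorem orientationPreserving_boost (β : ℝ) (hβ : |β| < 1) :
    OrientationPreserving (boost β hβ) := by
  have hs : ∀ s : unitInterval, |(s : ℝ) * β| < 1 := fun s => by
    rw [abs_mul, abs_of_nonneg s.2.1]
    nlinarith [s.2.1, s.2.2, abs_nonneg β]
  refine ⟨fun s => boost (s * β) (hs s), ?_, ?_, ?_, fun _ _ h => h.elim⟩
  · exact continuous_boostFun (β := fun y : unitInterval × Sphere => (y.1 : ℝ) * β) (by fun_prop)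
      continuous_snd fun y => hs y.1
  · ext1 x
    refine sphere_ext ?_ ?_ ?_
    · change (x.1.1.re + (0 : ℝ) * β) / (1 + (0 : ℝ) * β * x.1.1.re) = _
      simp
    · change √(1 - ((0 : ℝ) * β) ^ 2) * x.1.1.im / (1 + (0 : ℝ) * β * x.1.1.re) = _
      simp
    · change √(1 - ((0 : ℝ) * β) ^ 2) * x.1.2 / (1 + (0 : ℝ) * β * x.1.1.re) = _
      simp
  · simp

/-- The tilt turns the polar axis into the direction 1, the boost acts on that coordinate by t ↦
(t+β)/(1+βt), and a rotation brings the direction to `φ`. In particular the equator goes to the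
circle of height `β`. -/
theorem exists_orientationPreserving_height (φ β : ℝ) (hβ : |β| < 1) :
    ∃ g : Sphere ≃ₜ Sphere, OrientationPreserving g ∧
      ∀ x, height (Circle.exp φ) (g x) * (1 + β * x.1.2) = x.1.2 + β := by
  refine ⟨latitudeRotation (.const ℝ φ) * (boost β hβ * tilt (Real.pi / 2)),
    (orientationPreserving_latitudeRotation _).mul
      ((orientationPreserving_boost β hβ).mul (orientationPreserving_tilt _)), fun x => ?_⟩
  have h1 := height_mul_latitudeRotation 1 φ (boost β hβ (tilt (Real.pi / 2) x))
  rw [mul_one] at h1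
  have h2 : (tilt (Real.pi / 2) x).1.1.re = x.1.2 := by
    change Real.cos (Real.pi / 2) * x.1.1.re + Real.sin (Real.pi / 2) * x.1.2 = _
    simp
  have h3 : ∀ y, height 1 (boost β hβ y) = (y.1.1.re + β) / (1 + β * y.1.1.re) := by
    intro y
    simp only [height, Circle.coe_one, map_one, mul_one]
    rfl
  have h4 := (one_add_mul_re_pos hβ (tilt (Real.pi / 2) x)).ne'
  change height _ (latitudeRotation _ (boost β hβ (tilt (Real.pi / 2) x))) * _ = _
  rw [h1, h3]
  rw [h2] at h4 ⊢
  exact div_mul_cancel₀ _ h4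

/-! ### Fitting the annulus between the punctures -/

theorem cos_le_cos_pi_div (hp : 5 ≤ p) {c d : ℝ} (hc : 0 ≤ c) (hcd : c ≤ d) (hd : d ≤ 2 * p - c) :
    Real.cos (d * Real.pi / p) ≤ Real.cos (c * Real.pi / p) := by
  have hp' : (p : ℝ) ≠ 0 := by positivity
  rcases hcd.eq_or_lt with rfl | h
  · rfl
  · by_cases h' : d = 2 * p - c
    · rw [h', show (2 * p - c) * Real.pi / p = 2 * Real.pi - c * Real.pi / p by field_simp,
        Real.cos_two_pi_sub]
    · exact (cos_lt_cos_pi_div hp hc h hd h').le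

theorem height_puncture_gap (hp : 5 ≤ p) (j : ℕ) {x : Sphere} (hx : x ∈ punctures p) :
    Real.cos (1 * Real.pi / p) ≤ height (sideMid p j) x ∨
      height (sideMid p j) x ≤ Real.cos (3 * Real.pi / p) := by
  obtain ⟨r, hr, rfl⟩ := exists_vertex_eq hp j hx
  rw [height_vertex]
  match r with
  | 0 =>
    left
    rw [← Real.cos_neg ((_ - _) * _ / _)]
    apply le_of_eq
    congr 1
    push_cast
    ring
  | 1 =>
    left
    apply le_of_eq
    congr 1
    push_cast
    ring
  | r + 2 =>
    right
    have h : (r : ℝ) + 3 ≤ p := by exact_mod_cast hr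
    have h0 : (0 : ℝ) ≤ r := by positivity
    have := cos_le_cos_pi_div hp (c := 3) (d := 2 * r + 3) (by norm_num) (by linarith) (by linarith)
    convert this using 3
    push_cast
    ring

/-- The map t ↦ (t+β)/(1+βt) is increasing; `h` says that its value at 1/4 is below `c`, and `ht`
that its value at `t` is at least `c` when 1 + βt > 0. -/
theorem quarter_lt_of_boost_le {β c t : ℝ} (hβ : |β| < 1) (hc : |c| ≤ 1)
    (h : 4 * β + 1 < c * (4 + β)) (ht : c * (1 + β * t) ≤ t + β) : 1 / 4 < t := by
  have h1 : c * β < 1 := by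
    refine (le_abs_self _).trans_lt ?_
    rw [abs_mul]
    exact mul_lt_one_of_nonneg_of_lt_one_right hc (abs_nonneg _) hβ
  by_contra! h2
  have := mul_nonneg (sub_nonneg.2 h2) (sub_nonneg.2 h1.le)
  linarith

/-- This keeps the statement about all twists about α from being vacuous. -/
theorem exists_isPositiveDehnTwist_sideClass (hp : 5 ≤ p) (j : ℕ) :
    ∃ D : Homeo p, IsPositiveDehnTwist (sideClass hp j) D := by
  have hp' : (0 : ℝ) < p := by positivity
  have h5 : (5 : ℝ) ≤ p := by exact_mod_cast hp
  have hpi := Real.pi_pos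
  -- The double and triple angle formulas express cos(π/p) and β = cos(3π/(2p)) as polynomials in
  -- `k`, and cos(3π/p) as one in `β`. Polynomial inequalities on 7/8 < k < 1 then suffice for every
  -- `p`.
  obtain ⟨k, hk⟩ : ∃ k, k = Real.cos (Real.pi / p / 2) := ⟨_, rfl⟩
  obtain ⟨β, hβ⟩ : ∃ β, β = Real.cos (3 / 2 * Real.pi / p) := ⟨_, rfl⟩
  have hβk : β = 4 * k ^ 3 - 3 * k := by
    rw [hβ, hk, ← Real.cos_three_mul]
    congr 1
    ring
  have hC : Real.cos (1 * Real.pi / p) = 2 * k ^ 2 - 1 := by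
    rw [hk, ← Real.cos_two_mul]
    congr 1
    ring
  have hc : Real.cos (3 * Real.pi / p) = 2 * β ^ 2 - 1 := by
    rw [hβ, ← Real.cos_two_mul]
    congr 1
    ring
  have hz : Real.pi / p / 2 < 1 / 2 := by
    rw [div_div, div_lt_div_iff₀ (by positivity) two_pos]
    nlinarith [Real.pi_lt_four]
  have hz0 : 0 < Real.pi / p / 2 := by positivity
  have hk1 : k < 1 := by
    rw [hk, ← Real.cos_zero]
    exact Real.cos_lt_cos_of_nonneg_of_le_pi le_rfl (by linarith [Real.pi_gt_three]) hz0
  have hk0 : 7 / 8 < k := by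
    rw [hk]
    nlinarith [Real.one_sub_sq_div_two_le_cos (x := Real.pi / p / 2)]
  have hβ0 : 0 ≤ β := by
    rw [hβk]
    nlinarith [mul_pos (sub_pos.2 hk0) (sub_pos.2 hk0)]
  have hβ1 : β < 1 := by
    rw [hβk]
    nlinarith [mul_pos (sub_pos.2 hk1) (sub_pos.2 hk0),
      mul_pos (mul_pos (sub_pos.2 hk1) (sub_pos.2 hk0)) (sub_pos.2 hk0)]
  -- `hlow` and `hhigh` say that the boundary circles t = -1/4 and t = 1/4 land above height
  -- cos(3π/p) and below height cos(π/p), the heights of the nearest punctures.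
  have hlow : (2 * β ^ 2 - 1) * (4 - β) < 4 * β - 1 := by
    have : 0 < (1 - β) * (-2 * β ^ 2 + 6 * β + 3) := mul_pos (by linarith) (by nlinarith)
    nlinarith
  have hhigh : 4 * β + 1 < (2 * k ^ 2 - 1) * (4 + β) := by
    have h1 : 8 * k ^ 4 + 8 * k ^ 3 - 18 * k ^ 2 - 10 * k + 5 < 0 := by
      have : k ^ 2 < 1 := by nlinarith
      have : k ^ 4 ≤ k ^ 2 := by nlinarith
      have : k ^ 3 ≤ k := by nlinarith
      nlinarith
    have : 0 < (k - 1) * (8 * k ^ 4 + 8 * k ^ 3 - 18 * k ^ 2 - 10 * k + 5) :=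
      mul_pos_of_neg_of_neg (by linarith) h1
    rw [hβk]
    nlinarith
  have hβ' : |β| < 1 := abs_lt.2 ⟨by linarith, hβ1⟩
  obtain ⟨g, hg, hgh⟩ := exists_orientationPreserving_height ((2 * j + 1) * Real.pi / p) β hβ'
  change ∀ x, height (sideMid p j) (g x) * _ = _ at hgh
  have hA : ∀ x : Sphere, |x.1.2| ≤ 1 / 4 → g x ∉ punctures p := by
    intro x hx hxp
    obtain ⟨h1, h2⟩ := abs_le.1 hx
    have hx' := hgh x
    have h3 : 0 < 1 + β * x.1.2 := by nlinarith
    rcases height_puncture_gap hp j hxp with h | h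
    · have h4 := mul_le_mul_of_nonneg_right h h3.le
      rw [hx'] at h4
      rw [← hC] at hhigh
      exact h2.not_gt (quarter_lt_of_boost_le hβ' (Real.abs_cos_le_one _) hhigh h4)
    · have h4 := mul_le_mul_of_nonneg_right h h3.le
      rw [hx'] at h4
      rw [← hc] at hlow
      -- Changing the signs of `β`, `c` and `t` turns the lower boundary into the upper one.
      have := quarter_lt_of_boost_le (β := -β) (c := -Real.cos (3 * Real.pi / p)) (t := -x.1.2)
        (by rwa [abs_neg]) (by rw [abs_neg]; exact Real.abs_cos_le_one _) (by linarith)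
        (by linarith)
      linarith
  obtain ⟨f, hf⟩ : ∃ f, f = g * equatorTwist * g⁻¹ := ⟨_, rfl⟩
  have hfix : ∀ q ∈ punctures p, f q = q := by
    intro q hq
    have : 1 / 4 < |(g.symm q).1.2| := by
      by_contra! h
      exact hA _ h (by rwa [g.apply_symm_apply])
    rw [hf]
    change g (equatorTwist (g.symm q)) = q
    rw [← rampTwist_two, rampTwist_eq_self (by linarith), g.apply_symm_apply]
  refine ⟨⟨f, fun x => ⟨fun hx => ?_, fun hx => by rwa [hfix x hx]⟩⟩, g, sideCurve p j hp, hg,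
    ?_, ?_, rfl, hf⟩
  · rwa [← f.injective (hfix _ hx)]
  · rw [Set.disjoint_left]
    rintro y ⟨x, hx, hy⟩
    rw [← hy]
    exact hA x hx
  · rw [sideCurve_carrier, ← hβ]
    ext y
    obtain ⟨x, rfl⟩ := g.surjective y
    rw [g.injective.mem_set_image]
    have hx := hgh x
    constructor
    · intro h
      rw [show height (sideMid p j) (g x) = β from h] at hx
      have : x.1.2 * (1 - β ^ 2) = 0 := by linarith
      exact (mul_eq_zero.1 this).resolve_right (by nlinarith)
    · intro h
      rw [show x.1.2 = 0 from h] at hx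
      change height (sideMid p j) (g x) = β
      linarith

/-! ### The sequence -/

/-- Conjugation by Φ_k must keep a positive twist positive. -/
theorem orientationPreserving_Phi {D : Homeo p} (hD : OrientationPreserving D.1) (m : ℕ)
    (e : ℕ → ℕ) (k : ℕ) : OrientationPreserving (Phi D m e k).1 := by
  have hpow : ∀ n : ℕ, OrientationPreserving (D ^ n).1 := by
    intro n
    induction n with
    | zero => exact IsotopicToId.one _
    | succ n ih =>
      rw [pow_succ]
      exact ih.mul hD
  induction k with
  | zero => exact IsotopicToId.one _
  | succ k ih => exact ih.mul ((hpow _).mul (orientationPreserving_latitudeRotation _))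

theorem pow_smul_eq_of_smul_eq {G X : Type*} [Group G] [MulAction G X] {g : G} {x : X}
    (h : g • x = x) (n : ℕ) : g ^ n • x = x := by
  induction n with
  | zero => simp
  | succ n ih => rw [pow_succ, mul_smul, h, ih]

section Sequence

variable {m s : ℕ} {hp : 5 ≤ p} {D : Homeo p}

/-- Modulo p, the two neighbours of side s+2m are s+2i with i = 0 and i = 2m, exactly the excluded
values. -/
theorem IsPositiveDehnTwist.smul_sideClass (hm : 2 * m + 1 = p)
    (hD : IsPositiveDehnTwist (sideClass hp (s + 2 * m)) D) {i : ℕ} (hi : 1 ≤ i)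
    (him : i + 1 ≤ 2 * m) : D • sideClass hp (s + 2 * i) = sideClass hp (s + 2 * i) := by
  rcases lt_trichotomy i m with h | rfl | h
  · exact hD.smul_of_disjoint (disjoint_sideCurve hp (by omega) (by omega)).symm
  · exact hD.smul_self
  · exact hD.smul_of_disjoint (disjoint_sideCurve hp (by omega) (by omega))

theorem Phi_succ_smul_sideClass (e : ℕ → ℕ) (k i : ℕ) :
    Phi D m e (k + 1) • sideClass hp (s + 2 * i) =
      Phi D m e k • D ^ e (k + m) • sideClass hp (s + 2 * (i + 1)) := by
  rw [Phi, mul_smul, mul_smul, rho_smul_sideClass]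
  rfl

/-- Peeling off the factors D^e ρ one at a time, each ρ advances the side by two and each power of D
meets a side curve that it fixes. -/
theorem Phi_add_smul_sideClass (hm : 2 * m + 1 = p)
    (hD : IsPositiveDehnTwist (sideClass hp (s + 2 * m)) D) (e : ℕ → ℕ) (k i : ℕ)
    (hi : i + 1 ≤ 2 * m) :
    Phi D m e (k + i) • sideClass hp s = Phi D m e k • sideClass hp (s + 2 * i) := by
  induction i generalizing k with
  | zero => rfl
  | succ i ih =>
    rw [show k + (i + 1) = k + 1 + i by omega, ih _ (by omega), Phi_succ_smul_sideClass,
      pow_smul_eq_of_smul_eq (hD.smul_sideClass hm (by omega) hi)]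

theorem Phi_add_two_mul_smul_sideClass (hm : 2 * m + 1 = p)
    (hD : IsPositiveDehnTwist (sideClass hp (s + 2 * m)) D) (e : ℕ → ℕ) (k : ℕ) :
    Phi D m e (k + 2 * m) • sideClass hp s =
      Phi D m e k • D ^ e (k + m) • sideClass hp (s + 4 * m) := by
  rw [show k + 2 * m = k + 1 + (2 * m - 1) by omega,
    Phi_add_smul_sideClass hm hD e (k + 1) _ (by omega), Phi_succ_smul_sideClass]
  congr 4
  omega

theorem satisfiesP_Phi (hm : 2 * m + 1 = p)
    (hD : IsPositiveDehnTwist (sideClass hp (s + 2 * m)) D) (e : ℕ → ℕ) :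
    SatisfiesP m 2 2 e fun k => Phi D m e k • sideClass hp s where
  m_pos := by omega
  m_le := by omega
  b_pos := two_pos
  b_le := le_rfl
  disjoint k := by
    have h : PairwiseDisjointCurves fun i : Fin m => sideClass hp (s + 2 * i) := by
      refine ⟨fun i => sideCurve p (s + 2 * i) hp, fun _ => rfl, fun i j hij => ?_⟩
      have := Fin.val_ne_of_ne hij
      rcases lt_or_gt_of_ne this with h | h
      · exact disjoint_sideCurve hp (by omega) (by omega)
      · exact (disjoint_sideCurve hp (by omega) (by omega)).symm
    convert h.smul (Phi D m e k) using 2 with i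
    exact Phi_add_smul_sideClass hm hD e k i (by omega)
  fill k := by
    have h : Fills fun i : Fin (2 * m) => sideClass hp (s + 2 * i) := by
      intro δ
      -- Starting at s+2m, the p-1 consecutive sides omit only s+4m. Even `r = 2q` gives i = q+m,
      -- and odd `r = 2q+1` gives i = q after subtracting p.
      obtain ⟨r, hr, h⟩ := exists_intersection_sideClass_ne_zero hp (s + (p - 1)) δ
      rcases Nat.even_or_odd' r with ⟨q, rfl | rfl⟩
      · refine ⟨⟨q + m, by omega⟩, ?_⟩
        convert h using 3
        dsimp only
        omega
      · refine ⟨⟨q, by omega⟩, ?_⟩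
        rw [show s + (p - 1) + (2 * q + 1) = s + 2 * q + p by omega, sideClass_add_period] at h
        exact h
    convert h.smul (Phi D m e k) using 2 with i
    exact Phi_add_smul_sideClass hm hD e k i (by omega)
  twist k hk := by
    -- With k = l+m, the indices j from k-m to k+m-1 form the window l+i, 0 ≤ i < 2m, on which Φ_l
    -- can be cancelled; j = k is i = m.
    obtain ⟨l, rfl⟩ := Nat.exists_eq_add_of_le' hk
    have hγ : ∀ j, l ≤ j → j < l + 2 * m → ∃ i, j = l + i ∧ i < 2 * m ∧
        Phi D m e j • sideClass hp s = Phi D m e l • sideClass hp (s + 2 * i) := by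
      intro j h1 h2
      obtain ⟨i, rfl⟩ := Nat.exists_eq_add_of_le h1
      exact ⟨i, rfl, by omega, Phi_add_smul_sideClass hm hD e l i (by omega)⟩
    -- Modulo p = 2m+1, the sides 2m and 2(m-1) are 4m+1 and 4m-1, the two neighbours of 4m.
    have hadj : ∀ i, (i = m ∨ i + 1 = m) →
        intersection (sideClass hp (s + 4 * m)) (sideClass hp (s + 2 * i)) = 2 := by
      rintro i (rfl | rfl)
      · rw [← sideClass_add_period hp (s + 2 * i)]
        convert intersection_sideClass_succ hp (s + 4 * i) using 3
        omega
      · rw [← sideClass_add_period hp (s + 2 * i)]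
        convert intersection_sideClass_pred hp (s + 2 * i + p) using 3
        omega
    have hfar : ∀ i, m < i → i < 2 * m →
        intersection (sideClass hp (s + 4 * m)) (sideClass hp (s + 2 * i)) = 0 := fun i h1 h2 =>
      intersection_sideClass_eq_zero hp (by omega) (by omega)
    have hfar' : ∀ i, i + 1 < m →
        intersection (sideClass hp (s + 4 * m)) (sideClass hp (s + 2 * i)) = 0 := fun i h1 => by
      rw [← sideClass_add_period hp (s + 2 * i)]
      exact intersection_sideClass_eq_zero hp (by omega) (by omega)
    refine ⟨Phi D m e l • sideClass hp (s + 4 * m), ⟨Phi D m e l * D * (Phi D m e l)⁻¹, ?_, ?_⟩,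
      ?_, ?_, ?_⟩
    · rw [Phi_add_smul_sideClass hm hD e l m (by omega)]
      exact hD.conj (orientationPreserving_Phi (orientationPreserving_of_isPositiveDehnTwist hD) _ _ _)
    · rw [conj_pow, mul_smul, inv_smul_smul, mul_smul, ← Phi_add_two_mul_smul_sideClass hm hD, two_mul,
        add_assoc]
    · intro j h1 h2
      obtain ⟨i, rfl, hi, h⟩ := hγ j (by omega) (by omega)
      rw [h, intersection_smul]
      rcases lt_trichotomy i m with h' | h' | h'
      · rcases Nat.lt_or_eq_of_le (Nat.succ_le_of_lt h') with h'' | h''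
        · rw [hfar' i h'']
          exact bot_le
        · exact (hadj i (.inr h'')).le
      · exact (hadj i (.inl h')).le
      · rw [hfar i h' hi]
        exact bot_le
    · intro j hj
      obtain ⟨i, rfl, hi, h⟩ := hγ j (by omega) (by omega)
      rw [h, intersection_smul]
      exact hadj i (by omega)
    · intro j h1 h2
      obtain ⟨i, rfl, hi, h⟩ := hγ j (by omega) (by omega)
      rw [h, intersection_smul]
      exact hfar i (by omega) hi

end Sequence

end PuncturedSphere

theorem proposition3p1 (p : ℕ) (hp : 5 ≤ p) (hodd : Odd p) (e : ℕ → ℕ) (he : ∀ k, 0 < e k)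
    (m : ℕ) (hm : m = (p - 1) / 2) (s : ℕ)
    (γ₀ α : PuncturedSphere.Curve p)
    (hγ₀ : γ₀ = (PuncturedSphere.sideCurve p s hp).toCurve)
    (hα : α = PuncturedSphere.rho p ^ m • γ₀) :
    (∃ D : PuncturedSphere.Homeo p, PuncturedSphere.IsPositiveDehnTwist α D) ∧
    ∀ D : PuncturedSphere.Homeo p, PuncturedSphere.IsPositiveDehnTwist α D →
      PuncturedSphere.SatisfiesP m 2 2 e (fun k => PuncturedSphere.Phi D m e k • γ₀) := by
  have hm' : 2 * m + 1 = p := by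
    obtain ⟨n, rfl⟩ := hodd
    omega
  have hα' : α = PuncturedSphere.sideClass hp (s + 2 * m) := by
    rw [hα, hγ₀]
    exact PuncturedSphere.rho_pow_smul_sideClass hp s m
  subst hα' hγ₀
  exact ⟨PuncturedSphere.exists_isPositiveDehnTwist_sideClass hp _,
    fun D hD => PuncturedSphere.satisfiesP_Phi hm' hD e⟩
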